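/- Let $M$ be a smooth manifold (finite-dimensional, Hausdorff, second countable, without boundary) with a smooth action of the torus $\mathbb{T}^2=S^1\times S^1$, and let $X_1,X_2\in\Gamma(TM)$ be its infinitesimal generators, i.e. the vector fields whose integral curves are $t\mapsto(e^{it},1)\cdot x$ and $t\mapsto(1,e^{it})\cdot x$, respectively. Let $h_1,h_2\in C^\infty(M)$ be $\mathbb{T}^2$-invariant functions and $Y_1,Y_2\in\Gamma(TM)$ be $\mathbb{T}^2$-invariant smooth vector fields such that $$\mathrm{d}h_i(Y_1)\,X_1+\mathrm{d}h_i(Y_2)\,X_2=X_i\quad\text{on } M,\qquad i=1,2.$$ Put $\pi:=Y_1\wedge X_1+Y_2\wedge X_2\in\Gamma(\wedge^2TM)$ and let $U\subseteq M$ be the open set of points at which $X_1$ and $X_2$ are linearly independent. Let $\mathcal{L}$ be the foliation of $U$ by common level sets of $h_1,h_2$, so that $T_x\mathcal{L}=\ker \mathrm{d}_xh_1\cap\ker \mathrm{d}_xh_2$, and let $T_x\mathcal{O}$ be the tangent space at $x$ of the $\mathbb{T}^2$-orbit through $x$. By a foliation $\mathcal{S}$ of $M$ we mean a possibly singular foliation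 in the sense of Stefan and Sussmann, given by its tangent distribution $x\mapsto T_x\mathcal{S}\subseteq T_xM$, whose rank may vary: every vector in $T_x\mathcal{S}$ is the value at $x$ of a smooth vector field on $M$ with values in $T\mathcal{S}$, and through every point of $M$ there passes an immersed submanifold whose tangent space at each of its points $p$ is $T_p\mathcal{S}$. It is called compatible with $\mathcal{L}$ and $\mathcal{O}$ on $U$ if, for every $x\in U$, $$T_x\mathcal{S}+T_x\mathcal{L}=T_xM,\qquad T_x\mathcal{O}\subseteq T_x\mathcal{S},\qquad T_x\mathcal{O}=T_x\mathcal{S}\cap T_x\mathcal{L}.$$ Then $\pi$ is a Poisson structure on $M$, i.e. $[\pi,\pi]=0$ for the Schouten–Nijenhuis bracket, if and only if there exists a foliation $\mathcal{S}$ of $M$ that is compatible with $\mathcal{L}$ and $\mathcal{O}$ on $U$ and such that $Y_1(x),Y_2(x)\in T_x\mathcal{S}$ for every $x\in U$. -/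

import Mathlib

open scoped Manifold ContDiff

noncomputable section

namespace ToricPoisson

section Basic

variable {n : ℕ} {M : Type*} [TopologicalSpace M] [ChartedSpace (EuclideanSpace ℝ (Fin n)) M]

/-- A (not necessarily smooth) vector field on `M`. -/
abbrev VectorField (n : ℕ) (M : Type*) [TopologicalSpace M]
    [ChartedSpace (EuclideanSpace ℝ (Fin n)) M] :=
  ∀ x : M, TangentSpace (𝓡 n) x

/-- A (not necessarily smooth) bivector field: a section of `⋀² TM`. -/
abbrev BivectorField (n : ℕ) (M : Type*) [TopologicalSpace M]
    [ChartedSpace (EuclideanSpace ℝ (Fin n)) M] :=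
  ∀ x : M, ⋀[ℝ]^2 (TangentSpace (𝓡 n) x)

/-- Smoothness of a vector field, as a section of the tangent bundle. -/
def VectorField.Smooth [IsManifold (𝓡 n) ∞ M] (X : VectorField n M) : Prop :=
  ContMDiff (𝓡 n) (𝓡 n).tangent ∞ (fun x => (⟨x, X x⟩ : TangentBundle (𝓡 n) M))

/-- The differential of a real function at `x`, as a covector at `x`. -/
def differential (n : ℕ) {M : Type*} [TopologicalSpace M]
    [ChartedSpace (EuclideanSpace ℝ (Fin n)) M] (f : M → ℝ) (x : M) :
    Module.Dual ℝ (TangentSpace (𝓡 n) x) :=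
  (mfderiv (𝓡 n) 𝓘(ℝ, ℝ) f x).toLinearMap

/-- The bivector field `Y ∧ X`. -/
def wedge (Y X : VectorField n M) : BivectorField n M :=
  fun x => exteriorPower.ιMulti ℝ 2 ![Y x, X x]

/-- The bracket `{f, g} = π(df, dg)`, where `(v ∧ w)(α, β) = α(v) β(w) - α(w) β(v)`. -/
def bracket (π : BivectorField n M) (f g : M → ℝ) : M → ℝ := fun y =>
  exteriorPower.pairingDual ℝ (TangentSpace (𝓡 n) y) 2
    (exteriorPower.ιMulti ℝ 2 ![differential n f y, differential n g y]) (π y)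

/-- The function that is linear in the preferred chart at `x` and whose differential at `x` is
the covector `α`; it is smooth near `x`. For `α = dxⁱ` it is the coordinate function `xⁱ`. -/
def linearCoord (x : M) (α : Module.Dual ℝ (TangentSpace (𝓡 n) x)) : M → ℝ :=
  fun y => α (extChartAt (𝓡 n) x y)

/-- The Schouten–Nijenhuis bracket `[A, B]` of two bivector fields at the point `x`, as a trilinear
form on covectors, through its formula in the coordinates of the chart at `x`: its components are
`[A, B]ⁱʲᵏ = ∑ₗ (Aˡᵏ ∂ₗ Bⁱʲ + Bˡᵏ ∂ₗ Aⁱʲ) + (cyclic permutations of i, j, k)`.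
The overall sign depends on the convention, the condition `[A, B] = 0` does not. -/
def schoutenBracket (A B : BivectorField n M) (x : M)
    (α β γ : Module.Dual ℝ (TangentSpace (𝓡 n) x)) : ℝ :=
  let f := linearCoord x α
  let g := linearCoord x β
  let h := linearCoord x γ
  (bracket A (bracket B f g) h x + bracket B (bracket A f g) h x)
    + (bracket A (bracket B g h) f x + bracket B (bracket A g h) f x)
    + (bracket A (bracket B h f) g x + bracket B (bracket A h f) g x)

/-- `π` is a Poisson structure: a smooth bivector field with `[π, π] = 0`. -/
structure IsPoisson (π : BivectorField n M) : Prop where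
  smooth : ∀ f g : M → ℝ, ContMDiff (𝓡 n) 𝓘(ℝ, ℝ) ∞ f → ContMDiff (𝓡 n) 𝓘(ℝ, ℝ) ∞ g →
    ContMDiff (𝓡 n) 𝓘(ℝ, ℝ) ∞ (bracket π f g)
  schouten_self : ∀ (x : M) (α β γ : Module.Dual ℝ (TangentSpace (𝓡 n) x)),
    schoutenBracket π π x α β γ = 0

/-- A parametrized integral manifold of the distribution `D` through the point `x`: an injective
immersion `φ` of an open neighbourhood `W` of `0` in `ℝᵏ`, with `φ 0 = x`, whose tangent space at
each of its points `p` is exactly `D p`. -/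
structure IsIntegralManifoldAt (D : ∀ x : M, Submodule ℝ (TangentSpace (𝓡 n) x)) (x : M) {k : ℕ}
    (W : Set (EuclideanSpace ℝ (Fin k))) (φ : EuclideanSpace ℝ (Fin k) → M) : Prop where
  isOpen : IsOpen W
  zero_mem : 0 ∈ W
  map_zero : φ 0 = x
  smooth : ContMDiffOn (𝓡 k) (𝓡 n) ∞ φ W
  injOn : Set.InjOn φ W
  immersion : ∀ w ∈ W, Function.Injective (mfderiv (𝓡 k) (𝓡 n) φ w)
  tangent : ∀ w ∈ W, (mfderiv (𝓡 k) (𝓡 n) φ w).toLinearMap.range = D (φ w)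

/-- A foliation of `M`, possibly singular, in the sense of Stefan and Sussmann: a distribution
`TS`, whose rank may vary, which is smooth (every vector of it is the value of a
smooth vector field on `M` that takes values in it) and integrable (through every point of `M`
there passes an integral manifold). The leaves are the maximal connected integral manifolds. -/
structure Foliation (n : ℕ) (M : Type*) [TopologicalSpace M]
    [ChartedSpace (EuclideanSpace ℝ (Fin n)) M] [IsManifold (𝓡 n) ∞ M] where
  /-- the tangent distribution of the foliation -/
  tangent : ∀ x : M, Submodule ℝ (TangentSpace (𝓡 n) x)
  smooth : ∀ (x : M), ∀ v ∈ tangent x, ∃ Z : VectorField n M,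
    Z.Smooth ∧ (∀ y, Z y ∈ tangent y) ∧ Z x = v
  integrable : ∀ x : M, ∃ (k : ℕ) (W : Set (EuclideanSpace ℝ (Fin k)))
    (φ : EuclideanSpace ℝ (Fin k) → M), IsIntegralManifoldAt tangent x W φ

/-- The tangent space at `x` of the common level set of `h₁` and `h₂` through `x` (at points
where `dh₁` and `dh₂` are independent). -/
def levelTangent (n : ℕ) {M : Type*} [TopologicalSpace M]
    [ChartedSpace (EuclideanSpace ℝ (Fin n)) M] (h₁ h₂ : M → ℝ) (x : M) :
    Submodule ℝ (TangentSpace (𝓡 n) x) :=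
  (differential n h₁ x).ker ⊓ (differential n h₂ x).ker

/-- The set on which two vector fields are linearly independent. -/
def independenceSet (X₁ X₂ : VectorField n M) : Set M :=
  {x | LinearIndependent ℝ ![X₁ x, X₂ x]}

end Basic

section Action

variable {n : ℕ} {M : Type*} [TopologicalSpace M] [ChartedSpace (EuclideanSpace ℝ (Fin n)) M]
  [MulAction (Circle × Circle) M]

/-- `X₁` and `X₂` are the infinitesimal generators of the torus action, for the
standard basis of the Lie algebra `ℝ²`: the curves `t ↦ (e^{it}, 1) • x` and `t ↦ (1, e^{it}) • x`
are their integral curves. -/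
def AreGenerators (X₁ X₂ : VectorField n M) : Prop :=
  ∀ x : M, IsMIntegralCurve (I := 𝓡 n) (fun t : ℝ => ((Circle.exp t, 1) : Circle × Circle) • x) X₁ ∧
    IsMIntegralCurve (I := 𝓡 n) (fun t : ℝ => ((1, Circle.exp t) : Circle × Circle) • x) X₂

/-- A function invariant under the torus action. -/
def InvariantFunction (h : M → ℝ) : Prop :=
  ∀ (g : Circle × Circle) (x : M), h (g • x) = h x

/-- A vector field invariant under the torus action: each `g` pushes it forward to itself. -/
def InvariantVectorField (Y : VectorField n M) : Prop :=
  ∀ (g : Circle × Circle) (x : M),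
    mfderiv (𝓡 n) (𝓡 n) (fun y : M => g • y) x (Y x) = Y (g • x)

/-- The tangent space at `x` of the orbit through `x`: the image of the differential of the
orbit map `g ↦ g • x` at the unit (its value `1 • x` is `x`). -/
def orbitTangent (n : ℕ) {M : Type*} [TopologicalSpace M]
    [ChartedSpace (EuclideanSpace ℝ (Fin n)) M] [MulAction (Circle × Circle) M] (x : M) :
    Submodule ℝ (TangentSpace (𝓡 n) x) :=
  (mfderiv ((𝓡 1).prod (𝓡 1)) (𝓡 n) (fun g : Circle × Circle => g • x) 1).toLinearMap.range

/-- The foliation `S` is compatible, on the set `U`, with the foliation `L` by common level sets of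
`h₁` and `h₂` and the foliation `O` by orbits of the torus action: at the points of `U`,
`TS + TL = TM`, `TO ⊆ TS`, and `TO = TS ∩ TL`. -/
structure Foliation.IsCompatibleOn [IsManifold (𝓡 n) ∞ M] (S : Foliation n M) (h₁ h₂ : M → ℝ)
    (U : Set M) : Prop where
  transversal : ∀ x ∈ U, S.tangent x ⊔ levelTangent n h₁ h₂ x = ⊤
  invariant : ∀ x ∈ U, orbitTangent n x ≤ S.tangent x
  orbit_eq : ∀ x ∈ U, orbitTangent n x = S.tangent x ⊓ levelTangent n h₁ h₂ x

end Action

end ToricPoisson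

end

/-! The generators commute with each other, since the torus is abelian, and with the invariant
fields $Y_1,Y_2$. Expanding $[\pi,\pi]$ in coordinates therefore leaves only a nonzero multiple of
$[Y_1,Y_2]\wedge X_1\wedge X_2$ (`schoutenBracket_self`). Off $U$ this vanishes by itself, so $\pi$
is Poisson exactly when $[Y_1,Y_2]\in\langle X_1,X_2\rangle$ on $U$
(`isPoisson_iff_bracketAt_mem_span`). On $U$, the normalisation gives $dh_i(Y_j)=\delta_{ij}$, and
invariance of $h_i$ gives $dh_i(X_j)=0$.

If $\pi$ is Poisson, let $T\mathcal S$ be the span of $Y_1,Y_2,X_1,X_2$ on $U$ and $0$ elsewhere. It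
is involutive of rank 4 on $U$, so Frobenius provides integral manifolds there, and the points off
$U$ are leaves themselves (`exists_foliation_span_four`). Compatibility is linear algebra with the
covectors $dh_i$.

Conversely, $[Y_1,Y_2]$ is tangent to the integral manifolds of $\mathcal S$ because $Y_1,Y_2$ are
(`IsIntegralManifoldAt.bracketAt_mem`), and it is killed by $dh_1,dh_2$ because the functions
$dh_i(Y_j)$ are locally constant (`differential_bracketAt_eq_zero`). So it lies in $T\mathcal S\cap
T\mathcal L=T\mathcal O=\langle X_1,X_2\rangle$.

Frobenius is proved with flows. Smooth local flows come from the implicit function theorem on a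
space of paths (`exists_smooth_flow`). A flow of $Z$ that preserves $D$ also preserves $\langle
V\rangle+D$ when $[Z,V]\in D$ (`preserves_span_sup`), and flowing an integral map of $D$ along $Z$
yields one of $\langle Z\rangle+D$ (`HasIntegralMap.span_sup`). -/

noncomputable section

open scoped Topology
open Set Filter VectorField

namespace ToricPoisson

/-! ### Smoothness of superposition operators on spaces of continuous maps -/

section Superposition

universe u

variable {K : Type*} [TopologicalSpace K] [CompactSpace K]
  {E F : Type u} [NormedAddCommGroup E] [NormedSpace ℝ E] [NormedAddCommGroup F] [NormedSpace ℝ F]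

/-- Pointwise application of a continuous family of operators to a continuous family of vectors. -/
def pointwiseApply : C(K, E →L[ℝ] F) →L[ℝ] C(K, E) →L[ℝ] C(K, F) :=
  LinearMap.mkContinuous₂
    (LinearMap.mk₂ ℝ (fun (A : C(K, E →L[ℝ] F)) (γ : C(K, E)) =>
        (⟨fun s => A s (γ s), by fun_prop⟩ : C(K, F)))
      (fun A B γ => by ext; simp) (fun c A γ => by ext; simp)
      (fun A γ δ => by ext; simp) (fun c A γ => by ext; simp)) 1
    (fun A γ => by
      rw [one_mul]
      refine (ContinuousMap.norm_le _ (by positivity)).2 fun s => ?_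
      exact ((A s).le_opNorm _).trans
        (mul_le_mul (A.norm_coe_le_norm s) (γ.norm_coe_le_norm s) (norm_nonneg _) (norm_nonneg A)))

/-- The mean value inequality on each segment from `γ s` to `γ' s` reduces the estimate to a bound
on the variation of `f'` that is uniform in `s`. Continuity of `γ ↦ f'.comp γ` in the sup norm
supplies it. -/
theorem hasFDerivAt_continuousMap_comp (f : C(E, F)) (f' : C(E, E →L[ℝ] F))
    (hf : ∀ x, HasFDerivAt f (f' x) x) (γ : C(K, E)) :
    HasFDerivAt (fun γ : C(K, E) => f.comp γ) (pointwiseApply (f'.comp γ)) γ := by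
  refine .of_isLittleO (Asymptotics.isLittleO_iff.2 fun ε hε => ?_)
  have hc : ContinuousAt (fun γ : C(K, E) => f'.comp γ) γ :=
    (ContinuousMap.continuous_postcomp f').continuousAt
  obtain ⟨δ, hδ, H⟩ := (Metric.continuousAt_iff
    (f := fun γ : C(K, E) => f'.comp γ) (a := γ)).1 hc ε hε
  filter_upwards [Metric.ball_mem_nhds γ hδ] with γ' hγ'
  refine (ContinuousMap.norm_le _ (by positivity)).2 fun s => ?_
  have key : ‖f (γ' s) - f (γ s) - f' (γ s) (γ' s - γ s)‖ ≤ ε * ‖γ' s - γ s‖ := by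
    refine (convex_segment (γ s) (γ' s)).norm_image_sub_le_of_norm_hasFDerivWithin_le'
      (f' := fun x => f' x) (fun x _ => (hf x).hasFDerivWithinAt) ?_
      (left_mem_segment ℝ _ _) (right_mem_segment ℝ _ _)
    intro z hz
    rw [segment_eq_image'] at hz
    obtain ⟨r, hr, rfl⟩ := hz
    have h1 : dist (γ + r • (γ' - γ)) γ < δ := by
      rw [dist_eq_norm, add_sub_cancel_left, norm_smul, Real.norm_of_nonneg hr.1]
      rw [Metric.mem_ball, dist_eq_norm] at hγ'
      exact (mul_le_of_le_one_left (norm_nonneg _) hr.2).trans_lt hγ'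
    rw [← dist_eq_norm]
    exact (ContinuousMap.dist_apply_le_dist (f := f'.comp (γ + r • (γ' - γ)))
      (g := f'.comp γ) s).trans (H h1).le
  refine (show _ ≤ ε * ‖γ' s - γ s‖ from key).trans ?_
  gcongr
  exact (γ' - γ).norm_coe_le_norm s

/-- The derivative is again a superposition operator, that of `f'`, followed by a bounded linear
map. The induction must range over all targets, since the step replaces `F` by `E →L[ℝ] F`; hence
the common universe. -/
theorem contDiff_continuousMap_comp_nat (n : ℕ) : ∀ {E F : Type u} [NormedAddCommGroup E]
    [NormedSpace ℝ E] [NormedAddCommGroup F] [NormedSpace ℝ F] (f : C(E, F)),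
    ContDiff ℝ n f → ContDiff ℝ n (fun γ : C(K, E) => f.comp γ) := by
  induction n with
  | zero =>
    intro E F _ _ _ _ f _
    exact contDiff_zero.2 (ContinuousMap.continuous_postcomp f)
  | succ n ih =>
    intro E F _ _ _ _ f hf
    rw [Nat.cast_succ, contDiff_succ_iff_fderiv] at hf ⊢
    obtain ⟨hd, -, hc⟩ := hf
    set f' : C(E, E →L[ℝ] F) := ⟨fderiv ℝ f, hc.continuous⟩
    have hD := hasFDerivAt_continuousMap_comp (K := K) f f' fun x => (hd x).hasFDerivAt
    refine ⟨fun γ => (hD γ).differentiableAt, by simp, ?_⟩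
    rw [show fderiv ℝ (fun γ : C(K, E) => f.comp γ) = fun γ => pointwiseApply (f'.comp γ) from
      funext fun γ => (hD γ).fderiv]
    exact pointwiseApply.contDiff.comp (ih f' hc)

theorem contDiff_continuousMap_comp (f : C(E, F)) (hf : ContDiff ℝ ∞ f) :
    ContDiff ℝ ∞ (fun γ : C(K, E) => f.comp γ) :=
  contDiff_infty.2 fun n => contDiff_continuousMap_comp_nat n f (contDiff_infty.1 hf n)

end Superposition

/-! ### Implicit functions smooth on a neighbourhood -/

/-- The implicit function of a smooth equation is smooth at all points near the base point. -/
theorem exists_smooth_implicitFunction {E₁ E₂ F : Type*} [NormedAddCommGroup E₁]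
    [NormedSpace ℝ E₁] [CompleteSpace E₁] [NormedAddCommGroup E₂] [NormedSpace ℝ E₂]
    [CompleteSpace E₂] [NormedAddCommGroup F] [NormedSpace ℝ F] [CompleteSpace F]
    {f : E₁ × E₂ → F} (hf : ContDiff ℝ ∞ f) {u : E₁ × E₂}
    (hu : (fderiv ℝ f u ∘L .inr ℝ E₁ E₂).IsInvertible) :
    ∃ ψ : E₁ → E₂, ψ u.1 = u.2 ∧ (∀ᶠ x in 𝓝 u.1, ContDiffAt ℝ ∞ ψ x) ∧
      ∀ᶠ v in 𝓝 u, f v = f u ↔ ψ v.1 = v.2 := by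
  have h0 : (∞ : WithTop ℕ∞) ≠ 0 := by simp
  set ψ := hf.contDiffAt.implicitFunction h0 hu with hψ
  have hψu : ψ u.1 = u.2 := hf.contDiffAt.implicitFunction_apply_self h0 hu
  have hiff := hf.contDiffAt.eventually_apply_eq_iff_implicitFunction h0 hu
  have hsm : ContDiffAt ℝ ∞ ψ u.1 := hf.contDiffAt.contDiffAt_implicitFunction h0 hu
  refine ⟨ψ, hψu, ?_, hiff⟩
  have hcont : ∀ᶠ x in 𝓝 u.1, ContinuousAt ψ x := by
    have h1 : ContDiffAt ℝ 1 ψ u.1 := hsm.of_le (by exact_mod_cast le_top)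
    filter_upwards [h1.eventually (by simp)] with x hx using hx.continuousAt
  have hgraph : Tendsto (fun x => (x, ψ x)) (𝓝 u.1) (𝓝 u) := by
    have : ContinuousAt (fun x => (x, ψ x)) u.1 := continuousAt_id.prodMk hsm.continuousAt
    simpa [ContinuousAt, hψu] using this
  have hinv : ∀ᶠ v in 𝓝 u, (fderiv ℝ f v ∘L .inr ℝ E₁ E₂).IsInvertible := by
    obtain ⟨A, hA⟩ := hu
    have hc : Continuous fun v => fderiv ℝ f v ∘L .inr ℝ E₁ E₂ :=
      (hf.continuous_fderiv h0).clm_comp continuous_const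
    have h2 := A.nhds
    rw [hA] at h2
    filter_upwards [hc.continuousAt.preimage_mem_nhds h2] with v hv using hv
  filter_upwards [hcont, hgraph.eventually hinv, hgraph.eventually hiff.eventually_nhds]
    with x hx hxi hxiff
  -- `ContDiffAt ℝ ∞` at one point gives only finite orders nearby, on neighbourhoods that may
  -- shrink with the order. So the implicit function theorem is applied afresh at `(x, ψ x)`, and
  -- local uniqueness identifies the new implicit function with `ψ`.
  have hiff' := hf.contDiffAt.eventually_apply_eq_iff_implicitFunction h0 hxi
  have hsm' := hf.contDiffAt.contDiffAt_implicitFunction h0 hxi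
  refine hsm'.congr_of_eventuallyEq ?_
  have hg : Tendsto (fun y => (y, ψ y)) (𝓝 x) (𝓝 (x, ψ x)) :=
    (continuousAt_id.prodMk hx : ContinuousAt (fun y => (y, ψ y)) x)
  filter_upwards [hg.eventually hiff', hg.eventually hxiff] with y hy1 hy2
  have h3 := hxiff.self_of_nhds
  exact (hy1.1 ((hy2.2 rfl).trans (h3.2 rfl).symm)).symm

/-! ### Smooth local flows from the integral equation on paths -/

section Flow

universe u

/-- A path extended by its end values is continuous. -/
theorem continuous_comp_projIcc {E : Type*} [TopologicalSpace E] (γ : C(unitInterval, E)) :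
    Continuous fun r : ℝ => γ (projIcc 0 1 zero_le_one r) :=
  γ.continuous.comp continuous_projIcc

variable {E : Type u} [NormedAddCommGroup E] [NormedSpace ℝ E]

/-- The primitive of a path, as an operator on paths. -/
def pathPrimitive : C(unitInterval, E) →L[ℝ] C(unitInterval, E) :=
  LinearMap.mkContinuous
    { toFun := fun γ => ⟨fun s => ∫ r in (0 : ℝ)..s, γ (projIcc 0 1 zero_le_one r),
        (intervalIntegral.continuous_primitive
          (fun a b => (continuous_comp_projIcc γ).intervalIntegrable a b) 0).comp
          continuous_subtype_val⟩
      map_add' := fun γ δ => by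
        ext s
        exact intervalIntegral.integral_add ((continuous_comp_projIcc γ).intervalIntegrable _ _)
          ((continuous_comp_projIcc δ).intervalIntegrable _ _)
      map_smul' := fun c γ => by
        ext s
        exact intervalIntegral.integral_smul c _ } 1
    (fun γ => by
      rw [one_mul]
      refine (ContinuousMap.norm_le _ (norm_nonneg γ)).2 fun s => ?_
      refine (intervalIntegral.norm_integral_le_of_norm_le_const (C := ‖γ‖)
        fun r _ => γ.norm_coe_le_norm _).trans ?_
      rw [sub_zero, abs_of_nonneg s.2.1]
      exact mul_le_of_le_one_right (norm_nonneg γ) s.2.2)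

theorem pathPrimitive_apply (γ : C(unitInterval, E)) (s : unitInterval) :
    pathPrimitive γ s = ∫ r in (0 : ℝ)..s, γ (projIcc 0 1 zero_le_one r) := rfl

/-- Multiplication by `s` on the unit interval. -/
def unitScale (s : unitInterval) : C(unitInterval, unitInterval) := ⟨fun r => s * r, by fun_prop⟩

theorem smul_pathPrimitive_comp_unitScale (γ : C(unitInterval, E)) (s r : unitInterval) :
    (s : ℝ) • pathPrimitive (γ.comp (unitScale s)) r = pathPrimitive γ (s * r) := by
  rw [pathPrimitive_apply, pathPrimitive_apply]
  have h := intervalIntegral.smul_integral_comp_mul_left (a := 0) (b := (r : ℝ))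
    (fun x => γ (projIcc 0 1 zero_le_one x)) (s : ℝ)
  rw [mul_zero] at h
  refine Eq.trans ?_ h
  congr 1
  refine intervalIntegral.integral_congr fun x hx => ?_
  rw [uIcc_of_le r.2.1] at hx
  have hx' : x ∈ Icc (0 : ℝ) 1 := ⟨hx.1, hx.2.trans r.2.2⟩
  have hsx : (s : ℝ) * x ∈ Icc (0 : ℝ) 1 :=
    ⟨mul_nonneg s.2.1 hx'.1, mul_le_one₀ s.2.2 hx'.1 hx'.2⟩
  simp only [ContinuousMap.comp_apply, projIcc_of_mem zero_le_one hx',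
    projIcc_of_mem zero_le_one hsx]
  rfl

/-- The equation of the integral curves of `τ • f` starting at `p`, defined on `[0, 1]`. -/
def curveEquation (f : C(E, E)) (v : (E × ℝ) × C(unitInterval, E)) : C(unitInterval, E) :=
  v.2 - ContinuousMap.const _ v.1.1 - v.1.2 • pathPrimitive (f.comp v.2)

theorem contDiff_curveEquation (f : C(E, E)) (hf : ContDiff ℝ ∞ f) :
    ContDiff ℝ ∞ (curveEquation f) := by
  have h1 : ContDiff ℝ ∞ fun γ : C(unitInterval, E) => f.comp γ := contDiff_continuousMap_comp f hf
  have h2 : ContDiff ℝ ∞ fun p : E => ContinuousMap.const unitInterval p :=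
    (LinearMap.mkContinuous (⟨⟨fun p => ContinuousMap.const unitInterval p, fun _ _ => rfl⟩,
      fun _ _ => rfl⟩ : E →ₗ[ℝ] C(unitInterval, E)) 1 (fun p => by
        rw [one_mul]
        exact (ContinuousMap.norm_le _ (norm_nonneg p)).2 fun s => le_rfl)).contDiff
  unfold curveEquation
  exact (contDiff_snd.sub (h2.comp (contDiff_fst.comp contDiff_fst))).sub
    ((contDiff_snd.comp contDiff_fst).smul
      (pathPrimitive.contDiff.comp (h1.comp contDiff_snd)))

/-- At `τ = 0` the integral term disappears and the equation is affine in the path. This is why time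
enters as a factor `τ` over the fixed interval `[0, 1]`: the implicit function theorem applies for
every smooth `f`. -/
theorem fderiv_curveEquation_comp_inr (f : C(E, E)) (hf : ContDiff ℝ ∞ f) (p : E) :
    fderiv ℝ (curveEquation f) ((p, 0), ContinuousMap.const _ p) ∘L .inr ℝ _ _ =
      ContinuousLinearMap.id ℝ _ := by
  have h1 := ((contDiff_curveEquation f hf).differentiable (by simp)
    ((p, 0), ContinuousMap.const _ p)).hasFDerivAt
  have h2 := h1.comp (ContinuousMap.const unitInterval p)
    (hasFDerivAt_prodMk_right (𝕜 := ℝ) ((p, 0) : E × ℝ) (ContinuousMap.const unitInterval p))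
  refine h2.unique ?_
  have h3 : (curveEquation f ∘ fun γ : C(unitInterval, E) => ((p, (0 : ℝ)), γ)) =
      fun γ => γ - ContinuousMap.const _ p := by
    funext γ
    simp [curveEquation]
  rw [h3]
  exact (hasFDerivAt_id _).sub_const _

/-- Slowing a solution down by the factor `s` gives the solution with parameter `s * τ`. With
uniqueness, this relates interior values of one path to endpoints of others. -/
theorem curveEquation_comp_unitScale (f : C(E, E)) (p : E) (τ : ℝ) (γ : C(unitInterval, E))
    (h : curveEquation f ((p, τ), γ) = 0) (s : unitInterval) :
    curveEquation f ((p, s * τ), γ.comp (unitScale s)) = 0 := by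
  ext r
  have h1 := DFunLike.congr_fun h (s * r)
  simp only [curveEquation, ContinuousMap.sub_apply, ContinuousMap.const_apply,
    ContinuousMap.smul_apply, ContinuousMap.zero_apply, ContinuousMap.comp_apply] at h1 ⊢
  rw [← h1, ← smul_pathPrimitive_comp_unitScale, smul_smul, mul_comm]
  rfl

variable [CompleteSpace E]

/-- A smooth vector field has a local flow that depends smoothly on time and initial value. -/
theorem exists_smooth_flow (f : E → E) (hf : ContDiff ℝ ∞ f) (p₀ : E) :
    ∃ Φ : ℝ × E → E, (∀ᶠ z in 𝓝 (0, p₀), ContDiffAt ℝ ∞ Φ z) ∧ (∀ᶠ p in 𝓝 p₀, Φ (0, p) = p) ∧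
      ∀ᶠ z in 𝓝 (0, p₀), HasDerivAt (fun t => Φ (t, z.2)) (f (Φ z)) z.1 := by
  set g : C(E, E) := ⟨f, hf.continuous⟩
  have hG := contDiff_curveEquation g hf
  set c₀ : C(unitInterval, E) := ContinuousMap.const _ p₀ with hc₀
  have hinv : (fderiv ℝ (curveEquation g) ((p₀, 0), c₀) ∘L .inr ℝ _ _).IsInvertible := by
    rw [fderiv_curveEquation_comp_inr g hf p₀]
    exact ⟨.refl ℝ _, rfl⟩
  obtain ⟨Γ, hΓ0, hΓs, hΓi⟩ := exists_smooth_implicitFunction hG hinv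
  have hG0 : curveEquation g ((p₀, 0), c₀) = 0 := by simp [curveEquation, hc₀]
  simp only [hG0] at hΓi
  obtain ⟨ε, hε, hΓi⟩ := Metric.eventually_nhds_iff.1 hΓi
  have hΓc : ∀ᶠ z in 𝓝 (p₀, (0 : ℝ)), dist (Γ z) c₀ < ε := by
    have := hΓs.self_of_nhds.continuousAt.eventually (Metric.ball_mem_nhds _ hε)
    simp only [hΓ0] at this
    exact this
  obtain ⟨δ', hδ', hN'⟩ := Metric.eventually_nhds_iff.1 (hΓc.and hΓs)
  set δ := min δ' ε
  have hδ : 0 < δ := lt_min hδ' hε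
  have hN : ∀ p τ, dist p p₀ < δ → |τ| < δ → dist (Γ (p, τ)) c₀ < ε ∧ ContDiffAt ℝ ∞ Γ (p, τ) := by
    intro p τ hp hτ
    refine hN' ?_
    rw [Prod.dist_eq, Real.dist_eq, sub_zero]
    exact max_lt (hp.trans_le (min_le_left _ _)) (hτ.trans_le (min_le_left _ _))
  have huniq : ∀ p τ, dist p p₀ < δ → |τ| < δ → ∀ γ, dist γ c₀ < ε →
      (curveEquation g ((p, τ), γ) = 0 ↔ Γ (p, τ) = γ) := by
    intro p τ hp hτ γ hγ
    refine hΓi (y := ((p, τ), γ)) ?_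
    rw [Prod.dist_eq, Prod.dist_eq, Real.dist_eq, sub_zero]
    exact max_lt (max_lt (hp.trans_le (min_le_right _ _)) (hτ.trans_le (min_le_right _ _))) hγ
  -- The time-`τ` flow is the endpoint of the path solved with factor `τ`.
  set Φ : ℝ × E → E := fun z => Γ (z.2, z.1) 1 with hΦ
  have hscale : ∀ p τ, dist p p₀ < δ → |τ| < δ → ∀ s : unitInterval,
      Γ (p, τ) s = Φ (s * τ, p) := by
    intro p τ hp hτ s
    have hsτ : |s * τ| < δ := by
      rw [abs_mul, abs_of_nonneg s.2.1]
      exact (mul_le_of_le_one_left (abs_nonneg τ) s.2.2).trans_lt hτ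
    have h1 := (huniq p τ hp hτ _ (hN p τ hp hτ).1).2 rfl
    have h2 : dist ((Γ (p, τ)).comp (unitScale s)) c₀ < ε := by
      refine lt_of_le_of_lt ?_ (hN p τ hp hτ).1
      refine (ContinuousMap.dist_le dist_nonneg).2 fun r => ?_
      exact ContinuousMap.dist_apply_le_dist (f := Γ (p, τ)) (g := c₀) (s * r)
    have h3 := (huniq p _ hp hsτ _ h2).1 (curveEquation_comp_unitScale g p τ _ h1 s)
    rw [hΦ]
    simp only [h3, ContinuousMap.comp_apply]
    congr 1
    exact (mul_one s).symm
  have hint : ∀ p τ, dist p p₀ < δ → |τ| < δ → Φ (τ, p) = p + ∫ r in (0 : ℝ)..τ, f (Φ (r, p)) := by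
    intro p τ hp hτ
    have h1 := DFunLike.congr_fun ((huniq p τ hp hτ _ (hN p τ hp hτ).1).2 rfl) 1
    simp only [curveEquation, ContinuousMap.sub_apply, ContinuousMap.const_apply,
      ContinuousMap.smul_apply, ContinuousMap.zero_apply, pathPrimitive_apply] at h1
    rw [sub_sub, sub_eq_zero] at h1
    rw [show Φ (τ, p) = Γ (p, τ) 1 from rfl, h1]
    congr 1
    -- Substituting `r = x * τ` turns the path equation at its endpoint into the usual integral
    -- equation; `hscale` identifies the integrands.
    have h2 := intervalIntegral.smul_integral_comp_mul_right (a := 0) (b := 1)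
      (fun x => f (Φ (x, p))) τ
    rw [zero_mul, one_mul] at h2
    rw [← h2]
    congr 1
    refine intervalIntegral.integral_congr fun x hx => ?_
    rw [uIcc_of_le (by simp)] at hx
    have hx' : x ∈ Icc (0 : ℝ) 1 := hx
    simp only [ContinuousMap.comp_apply, projIcc_of_mem zero_le_one hx']
    exact congrArg f (hscale p τ hp hτ ⟨x, hx'⟩)
  have hΦs : ∀ p τ, dist p p₀ < δ → |τ| < δ → ContDiffAt ℝ ∞ Φ (τ, p) := by
    intro p τ hp hτ
    have h1 : ContDiffAt ℝ ∞ (fun z : ℝ × E => Γ (z.2, z.1)) (τ, p) :=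
      ((hN p τ hp hτ).2).comp (τ, p) (contDiffAt_snd.prodMk contDiffAt_fst)
    exact (ContinuousMap.evalCLM ℝ (1 : unitInterval) :
      C(unitInterval, E) →L[ℝ] E).contDiff.contDiffAt.comp (τ, p) h1
  have hnear : ∀ᶠ z in 𝓝 ((0 : ℝ), p₀), dist z.2 p₀ < δ ∧ |z.1| < δ := by
    filter_upwards [Metric.ball_mem_nhds ((0 : ℝ), p₀) hδ] with z hz
    rw [Metric.mem_ball, Prod.dist_eq, Real.dist_eq, sub_zero] at hz
    exact ⟨(le_max_right _ _).trans_lt hz, (le_max_left _ _).trans_lt hz⟩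
  refine ⟨Φ, ?_, ?_, ?_⟩
  · filter_upwards [hnear] with z hz using hΦs z.2 z.1 hz.1 hz.2
  · filter_upwards [Metric.ball_mem_nhds p₀ hδ] with p hp
    rw [hint p 0 hp (by simpa using hδ)]
    simp
  · filter_upwards [hnear] with z hz
    obtain ⟨hp, hτ⟩ := hz
    have hopen : IsOpen {t : ℝ | |t| < δ} := isOpen_lt continuous_abs continuous_const
    have hcont : ContinuousOn (fun r => f (Φ (r, z.2))) {t : ℝ | |t| < δ} := by
      intro r hr
      have h1 : ContinuousAt (fun r : ℝ => (r, z.2)) r := by fun_prop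
      exact (hf.continuous.continuousAt.comp
        (ContinuousAt.comp (f := fun r : ℝ => (r, z.2)) (hΦs z.2 r hp hr).continuousAt
          h1)).continuousWithinAt
    have hsub : uIcc 0 z.1 ⊆ {t : ℝ | |t| < δ} := by
      intro r hr
      have := abs_sub_left_of_mem_uIcc hr
      simp only [sub_zero] at this
      exact this.trans_lt hτ
    have h2 := intervalIntegral.integral_hasDerivAt_right (a := 0) (b := z.1)
      (hcont.mono hsub).intervalIntegrable
      (hcont.stronglyMeasurableAtFilter hopen z.1 hτ) (hcont.continuousAt (hopen.mem_nhds hτ))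
    refine (h2.const_add z.2).congr_of_eventuallyEq ?_
    filter_upwards [hopen.mem_nhds hτ] with t ht using hint z.2 t hp ht

end Flow

/-! ### Frobenius: distributions preserved by flows and integral maps -/

section Frobenius

universe u

variable {E : Type u} [NormedAddCommGroup E] [NormedSpace ℝ E]

/-- `Φ` is a smooth flow of the vector field `Z`, for small times and near `u₀`. -/
structure IsLocalFlow (Z : E → E) (Φ : ℝ × E → E) (u₀ : E) : Prop where
  smooth : ∀ᶠ z in 𝓝 (0, u₀), ContDiffAt ℝ ∞ Φ z
  map_zero : ∀ᶠ p in 𝓝 u₀, Φ (0, p) = p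
  hasDerivAt : ∀ᶠ z in 𝓝 (0, u₀), HasDerivAt (fun t => Φ (t, z.2)) (Z (Φ z)) z.1

/-- The derivative of a flow with respect to the initial value. -/
def spaceDeriv (Φ : ℝ × E → E) (z : ℝ × E) : E →L[ℝ] E := fderiv ℝ Φ z ∘L .inr ℝ ℝ E

variable {Z : E → E} {Φ : ℝ × E → E} {u₀ : E}

namespace IsLocalFlow

theorem fderiv_time (h : IsLocalFlow Z Φ u₀) :
    ∀ᶠ z in 𝓝 (0, u₀), fderiv ℝ Φ z (1, 0) = Z (Φ z) := by
  filter_upwards [h.smooth, h.hasDerivAt] with z hz hd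
  have h1 : HasDerivAt (fun t : ℝ => (t, z.2)) (1, 0) z.1 :=
    (hasDerivAt_id _).prodMk (hasDerivAt_const _ _)
  have h2 : HasFDerivAt Φ (fderiv ℝ Φ z) (z.1, z.2) :=
    (hz.differentiableAt (by simp)).hasFDerivAt
  exact (h2.comp_hasDerivAt z.1 h1).unique hd

theorem tendsto (h : IsLocalFlow Z Φ u₀) : Tendsto Φ (𝓝 (0, u₀)) (𝓝 u₀) := by
  have := h.smooth.self_of_nhds.continuousAt
  rwa [ContinuousAt, h.map_zero.self_of_nhds] at this

theorem spaceDeriv_zero (h : IsLocalFlow Z Φ u₀) :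
    ∀ᶠ p in 𝓝 u₀, spaceDeriv Φ (0, p) = ContinuousLinearMap.id ℝ E := by
  have hs : ∀ᶠ p in 𝓝 u₀, ContDiffAt ℝ ∞ Φ (0, p) := by
    have : Tendsto (fun p : E => ((0 : ℝ), p)) (𝓝 u₀) (𝓝 (0, u₀)) :=
      (Continuous.prodMk_right (0 : ℝ)).tendsto u₀
    exact this.eventually h.smooth
  filter_upwards [hs, h.map_zero.eventually_nhds] with p hp hp0
  have h1 := (hp.differentiableAt (by simp)).hasFDerivAt.comp p
    (hasFDerivAt_prodMk_right (𝕜 := ℝ) (0 : ℝ) p)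
  refine h1.unique ?_
  exact (hasFDerivAt_id p).congr_of_eventuallyEq (by filter_upwards [hp0] with q hq using hq)

theorem isInvertible_spaceDeriv (h : IsLocalFlow Z Φ u₀) [CompleteSpace E] :
    ∀ᶠ z in 𝓝 (0, u₀), (spaceDeriv Φ z).IsInvertible := by
  have h1 : ContinuousAt (spaceDeriv Φ) (0, u₀) :=
    (h.smooth.self_of_nhds.continuousAt_fderiv (by simp)).clm_comp continuousAt_const
  have h2 := (ContinuousLinearEquiv.refl ℝ E).nhds
  rw [ContinuousLinearEquiv.coe_refl, ← h.spaceDeriv_zero.self_of_nhds] at h2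
  filter_upwards [h1.preimage_mem_nhds h2] with z hz using hz

/-- The variational equation along a flow. -/
theorem hasDerivAt_spaceDeriv (h : IsLocalFlow Z Φ u₀) (hZ : ContDiff ℝ ∞ Z) :
    ∀ᶠ z in 𝓝 (0, u₀), HasDerivAt (fun t => spaceDeriv Φ (t, z.2))
      (fderiv ℝ Z (Φ z) ∘L spaceDeriv Φ z) z.1 := by
  filter_upwards [h.smooth, h.fderiv_time.eventually_nhds] with z hz ht
  have hd : HasFDerivAt (fderiv ℝ Φ) (fderiv ℝ (fderiv ℝ Φ) z) (z.1, z.2) :=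
    ((hz.fderiv_right (m := ∞) (by simp)).differentiableAt (by simp)).hasFDerivAt
  have h1 : HasDerivAt (fun t : ℝ => (t, z.2)) (1, 0) z.1 :=
    (hasDerivAt_id _).prodMk (hasDerivAt_const _ _)
  let R : ((ℝ × E) →L[ℝ] E) →L[ℝ] E →L[ℝ] E :=
    ContinuousLinearMap.precomp E (ContinuousLinearMap.inr ℝ ℝ E)
  have h2 : HasDerivAt (fun t => spaceDeriv Φ (t, z.2)) (R (fderiv ℝ (fderiv ℝ Φ) z (1, 0))) z.1 :=
    R.hasFDerivAt.comp_hasDerivAt z.1 (hd.comp_hasDerivAt z.1 h1)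
  refine h2.congr_deriv (ContinuousLinearMap.ext fun v => ?_)
  -- Symmetry exchanges the time and space derivatives, and the flow equation, valid near `z`, can
  -- then be differentiated in space.
  have hsymm := (hz.isSymmSndFDerivAt (by simpa using ENat.LEInfty.out)) (1, 0) (0, v)
  have h3 : HasFDerivAt (fun z => fderiv ℝ Φ z (1, 0))
      ((ContinuousLinearMap.apply ℝ E ((1 : ℝ), (0 : E))) ∘L fderiv ℝ (fderiv ℝ Φ) z) z :=
    (ContinuousLinearMap.apply ℝ E ((1 : ℝ), (0 : E))).hasFDerivAt.comp z hd
  have h4 : HasFDerivAt (fun z => fderiv ℝ Φ z (1, 0)) (fderiv ℝ Z (Φ z) ∘L fderiv ℝ Φ z) z :=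
    (((hZ.differentiable (by simp) (Φ z)).hasFDerivAt).comp z
      (hz.differentiableAt (by simp)).hasFDerivAt).congr_of_eventuallyEq ht
  have h5 := DFunLike.congr_fun (h3.unique h4) (0, v)
  exact hsymm.trans h5

/-- The derivative of the pullback of a vector field along a flow is the pullback of the
Lie bracket. -/
theorem hasDerivAt_pullback [CompleteSpace E] (h : IsLocalFlow Z Φ u₀) (hZ : ContDiff ℝ ∞ Z)
    {V : E → E} (hV : ContDiff ℝ ∞ V) :
    ∀ᶠ z in 𝓝 (0, u₀), HasDerivAt
      (fun t => (spaceDeriv Φ (t, z.2)).inverse (V (Φ (t, z.2))))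
      ((spaceDeriv Φ z).inverse (lieBracket ℝ Z V (Φ z))) z.1 := by
  filter_upwards [h.hasDerivAt_spaceDeriv hZ, h.isInvertible_spaceDeriv.eventually_nhds,
    h.hasDerivAt] with z hA hinv hd
  have hinv' := hinv.self_of_nhds
  have hI : DifferentiableAt ℝ (fun t => (spaceDeriv Φ (t, z.2)).inverse) z.1 := by
    have h1 : ContDiffAt ℝ 1 ContinuousLinearMap.inverse (spaceDeriv Φ (z.1, z.2)) :=
      hinv'.contDiffAt_map_inverse
    exact (h1.differentiableAt one_ne_zero).comp z.1 hA.differentiableAt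
  have hVΦ : HasDerivAt (fun t => V (Φ (t, z.2))) (fderiv ℝ V (Φ z) (Z (Φ z))) z.1 :=
    HasFDerivAt.comp_hasDerivAt (f := fun t => Φ (t, z.2)) z.1
      (hV.differentiable (by simp) (Φ z)).hasFDerivAt hd
  have hc := (hI.clm_apply hVΦ.differentiableAt).hasDerivAt
  -- Only differentiability of the inverse is used: its derivative is found by differentiating the
  -- product `spaceDeriv Φ * pullback = V ∘ Φ`.
  have hprod := hA.clm_apply hc
  have heq : ∀ᶠ t in 𝓝 z.1, spaceDeriv Φ (t, z.2)
      ((spaceDeriv Φ (t, z.2)).inverse (V (Φ (t, z.2)))) = V (Φ (t, z.2)) := by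
    have : Tendsto (fun t : ℝ => (t, z.2)) (𝓝 z.1) (𝓝 z) :=
      (Continuous.prodMk_left z.2).tendsto z.1
    filter_upwards [this.eventually hinv] with t ht
    exact ((ht.inverse_apply_eq).1 rfl).symm
  have hu := hprod.unique (hVΦ.congr_of_eventuallyEq heq)
  rw [show spaceDeriv Φ (z.1, z.2) = spaceDeriv Φ z from rfl, ContinuousLinearMap.comp_apply,
    heq.self_of_nhds] at hu
  refine hc.congr_deriv (Eq.symm ((hinv'.inverse_apply_eq).2 ?_))
  change fderiv ℝ V (Φ z) (Z (Φ z)) - fderiv ℝ Z (Φ z) (V (Φ z)) = _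
  rw [← hu]
  exact add_sub_cancel_left _ _

/-- The flow `Φ` preserves the distribution `D` near `u₀`. -/
def Preserves (Φ : ℝ × E → E) (u₀ : E) (D : E → Submodule ℝ E) : Prop :=
  ∀ᶠ z in 𝓝 ((0 : ℝ), u₀), (D z.2).map (spaceDeriv Φ z).toLinearMap = D (Φ z)

theorem preserves_bot (Φ : ℝ × E → E) (u₀ : E) : Preserves Φ u₀ fun _ => ⊥ :=
  .of_forall fun _ => Submodule.map_bot _

/-- The pullback of `V` along the flow has as derivative the pullback of `[Z, V]`. The latter stays
in the fixed space `D p`, because the flow preserves `D`. So the pullback is constant modulo `D p`,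
and the flow carries `V` to `V` modulo `D`. -/
theorem preserves_span_sup [FiniteDimensional ℝ E] (h : IsLocalFlow Z Φ u₀) (hZ : ContDiff ℝ ∞ Z)
    {V : E → E} (hV : ContDiff ℝ ∞ V) {D : E → Submodule ℝ E} (hD : Preserves Φ u₀ D)
    (hbr : ∀ᶠ p in 𝓝 u₀, lieBracket ℝ Z V p ∈ D p) :
    Preserves Φ u₀ fun p => Submodule.span ℝ {V p} ⊔ D p := by
  have := FiniteDimensional.complete ℝ E
  have hE := (h.hasDerivAt_pullback hZ hV).and (hD.and ((h.tendsto.eventually hbr).and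
    h.isInvertible_spaceDeriv))
  obtain ⟨δ, hδ, hN⟩ := Metric.eventually_nhds_iff.1 hE
  have h0 : ∀ᶠ z : ℝ × E in 𝓝 (0, u₀), Φ (0, z.2) = z.2 ∧
      spaceDeriv Φ (0, z.2) = ContinuousLinearMap.id ℝ E :=
    (continuous_snd.tendsto ((0 : ℝ), u₀)).eventually (h.map_zero.and h.spaceDeriv_zero)
  filter_upwards [Metric.ball_mem_nhds _ hδ, hE, h0] with z hz hEz h0z
  obtain ⟨-, hDz, -, hiz⟩ := hEz
  have hnear : ∀ t ∈ Metric.ball (0 : ℝ) δ, dist ((t, z.2) : ℝ × E) (0, u₀) < δ := by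
    intro t ht
    rw [Metric.mem_ball, Prod.dist_eq] at hz
    rw [Prod.dist_eq]
    exact max_lt ht ((le_max_right _ _).trans_lt hz)
  have hz1 : z.1 ∈ Metric.ball (0 : ℝ) δ := by
    rw [Metric.mem_ball, Prod.dist_eq] at hz
    exact (le_max_left _ _).trans_lt hz
  have hclosed : IsClosed (D z.2 : Set E) := Submodule.closed_of_finiteDimensional _
  set c : ℝ → E := fun t => (spaceDeriv Φ (t, z.2)).inverse (V (Φ (t, z.2))) with hc
  have hderiv : ∀ t ∈ Metric.ball (0 : ℝ) δ,
      HasDerivAt (fun t => (D z.2).mkQL (c t)) 0 t := by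
    intro t ht
    obtain ⟨h1, h2, h3, h4⟩ := hN (hnear t ht)
    have h5 := ((D z.2).mkQL).hasFDerivAt.comp_hasDerivAt t h1
    refine h5.congr_deriv ?_
    rw [← h2] at h3
    obtain ⟨w, hw, hwe⟩ := h3
    have h6 : (spaceDeriv Φ (t, z.2)).inverse (lieBracket ℝ Z V (Φ (t, z.2))) = w :=
      (h4.inverse_apply_eq).2 hwe.symm
    rw [h6]
    exact (Submodule.Quotient.mk_eq_zero _).2 hw
  have hconst : (D z.2).mkQL (c z.1) = (D z.2).mkQL (c 0) :=
    Metric.isOpen_ball.is_const_of_deriv_eq_zero (convex_ball (0 : ℝ) δ).isPreconnected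
      (fun t ht => (hderiv t ht).differentiableAt.differentiableWithinAt)
      (fun t ht => (hderiv t ht).deriv) hz1 (Metric.mem_ball_self hδ)
  have hmem : c z.1 - c 0 ∈ D z.2 := (Submodule.Quotient.eq _).1 hconst
  have hc0 : c 0 = V z.2 := by
    simp only [hc, h0z.1, h0z.2]
    simp
  have hcz : spaceDeriv Φ z (c z.1) = V (Φ z) := ((hiz.inverse_apply_eq).1 rfl).symm
  have hdiff : V (Φ z) - spaceDeriv Φ z (V z.2) ∈ D (Φ z) := by
    rw [← hDz, ← hcz, ← hc0, ← map_sub]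
    exact ⟨_, hmem, rfl⟩
  rw [Submodule.map_sup, hDz, Submodule.map_span, image_singleton]
  refine le_antisymm (sup_le ?_ le_sup_right) (sup_le ?_ le_sup_right)
  · rw [Submodule.span_singleton_le_iff_mem]
    have := Submodule.sub_mem _ (Submodule.mem_sup_left (Submodule.mem_span_singleton_self (V (Φ z))))
      (Submodule.mem_sup_right hdiff : _ ∈ Submodule.span ℝ {V (Φ z)} ⊔ D (Φ z))
    simpa using this
  · rw [Submodule.span_singleton_le_iff_mem]
    have := Submodule.add_mem _ (Submodule.mem_sup_left
      (Submodule.mem_span_singleton_self (spaceDeriv Φ z (V z.2))))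
      (Submodule.mem_sup_right hdiff : _ ∈ Submodule.span ℝ {spaceDeriv Φ z (V z.2)} ⊔ D (Φ z))
    simpa using this

end IsLocalFlow

/-- There is a smooth map from a neighbourhood of `0` in `ℝᵏ` that sends `0` to `u₀` and whose
derivative at each point maps onto the distribution `D`. -/
def HasIntegralMap (D : E → Submodule ℝ E) (u₀ : E) (k : ℕ) : Prop :=
  ∃ ψ : EuclideanSpace ℝ (Fin k) → E, ψ 0 = u₀ ∧ ∀ᶠ w in 𝓝 0, ContDiffAt ℝ ∞ ψ w ∧
    (fderiv ℝ ψ w).toLinearMap.range = D (ψ w)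

theorem hasIntegralMap_bot (u₀ : E) : HasIntegralMap (fun _ => ⊥) u₀ 0 := by
  refine ⟨fun _ => u₀, rfl, .of_forall fun w => ⟨contDiffAt_const, ?_⟩⟩
  simp

/-- The new map is `(t, v) ↦ Φ (t, ψ v)`: its `t`-derivative is `Z`, and its `v`-derivatives fill
the image of `D` under the flow, which is `D` again. Here `k` counts parameters, not rank, so no
independence is needed. -/
theorem HasIntegralMap.span_sup {D : E → Submodule ℝ E} {k : ℕ} (hD : HasIntegralMap D u₀ k)
    (h : IsLocalFlow Z Φ u₀) (hpres : IsLocalFlow.Preserves Φ u₀ D) :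
    HasIntegralMap (fun p => Submodule.span ℝ {Z p} ⊔ D p) u₀ (k + 1) := by
  obtain ⟨ψ, hψ0, hψ⟩ := hD
  let e : EuclideanSpace ℝ (Fin (k + 1)) ≃L[ℝ] ℝ × EuclideanSpace ℝ (Fin k) :=
    ContinuousLinearEquiv.ofFinrankEq (by simp [add_comm])
  set χ : EuclideanSpace ℝ (Fin (k + 1)) → ℝ × E := fun w => ((e w).1, ψ (e w).2) with hχ
  have hsnd : Tendsto (fun w => (e w).2) (𝓝 0) (𝓝 0) := by
    have : Continuous fun w => (e w).2 := by fun_prop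
    simpa using this.tendsto 0
  have hχ0 : Tendsto χ (𝓝 0) (𝓝 (0, u₀)) := by
    have h1 : ContinuousAt ψ 0 := hψ.self_of_nhds.1.continuousAt
    rw [ContinuousAt, hψ0] at h1
    have h2 : Tendsto (fun w => (e w).1) (𝓝 0) (𝓝 0) := by
      have : Continuous fun w => (e w).1 := by fun_prop
      simpa using this.tendsto 0
    exact h2.prodMk_nhds (h1.comp hsnd)
  refine ⟨fun w => Φ (χ w), ?_, ?_⟩
  · have : χ 0 = (0, u₀) := by simp [hχ, hψ0]
    simp only [this]
    exact h.map_zero.self_of_nhds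
  filter_upwards [hsnd.eventually hψ, hχ0.eventually h.smooth, hχ0.eventually h.fderiv_time,
    hχ0.eventually hpres] with w hψw hΦw htw hpw
  have hχw : ContDiffAt ℝ ∞ χ w :=
    (contDiff_fst.comp e.contDiff).contDiffAt.prodMk
      (hψw.1.comp w (contDiff_snd.comp e.contDiff).contDiffAt)
  have hχd : HasFDerivAt χ ((ContinuousLinearMap.fst ℝ _ _ ∘L e.toContinuousLinearMap).prod
      (fderiv ℝ ψ (e w).2 ∘L (ContinuousLinearMap.snd ℝ _ _ ∘L e.toContinuousLinearMap))) w :=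
    (hasFDerivAt_fst.comp w e.hasFDerivAt).prodMk
      ((hψw.1.differentiableAt (by simp)).hasFDerivAt.comp w
        (hasFDerivAt_snd.comp w e.hasFDerivAt))
  refine ⟨hΦw.comp w hχw, ?_⟩
  have hd := ((hΦw.differentiableAt (by simp)).hasFDerivAt.comp w hχd).fderiv
  have hd' : ∀ v, fderiv ℝ (fun w => Φ (χ w)) w v =
      (e v).1 • Z (Φ (χ w)) + spaceDeriv Φ (χ w) (fderiv ℝ ψ (e w).2 (e v).2) := by
    intro v
    rw [show (fun w => Φ (χ w)) = Φ ∘ χ from rfl, hd, ← htw, ← map_smul]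
    simp only [spaceDeriv, ContinuousLinearMap.comp_apply, ← map_add,
      ContinuousLinearMap.prod_apply, ContinuousLinearMap.inr_apply]
    simp
  have hDr : D (Φ (χ w)) = Submodule.map (spaceDeriv Φ (χ w)).toLinearMap
      (fderiv ℝ ψ (e w).2).toLinearMap.range := by rw [hψw.2, ← hpw]
  rw [hDr]
  apply le_antisymm
  · rintro _ ⟨v, rfl⟩
    refine (hd' v).symm ▸ ?_
    exact Submodule.add_mem_sup (Submodule.smul_mem _ _ (Submodule.mem_span_singleton_self _))
      ⟨_, ⟨_, rfl⟩, rfl⟩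
  · rw [sup_le_iff, Submodule.span_singleton_le_iff_mem]
    constructor
    · refine ⟨e.symm (1, 0), (hd' _).trans ?_⟩
      simp
    · rintro _ ⟨_, ⟨v, rfl⟩, rfl⟩
      refine ⟨e.symm (0, v), (hd' _).trans ?_⟩
      simp

/-- The distribution spanned by four vector fields `X₁, X₂, Y₁, Y₂` whose brackets vanish, except
for `[Y₁, Y₂]`, which lies in the span of `X₁` and `X₂`, has integral maps. -/
theorem hasIntegralMap_four [FiniteDimensional ℝ E] {X₁ X₂ Y₁ Y₂ : E → E} (u₀ : E)
    (hX₁ : ContDiff ℝ ∞ X₁) (hX₂ : ContDiff ℝ ∞ X₂) (hY₁ : ContDiff ℝ ∞ Y₁)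
    (hY₂ : ContDiff ℝ ∞ Y₂)
    (hXX : ∀ᶠ p in 𝓝 u₀, lieBracket ℝ X₁ X₂ p = 0)
    (h₁₁ : ∀ᶠ p in 𝓝 u₀, lieBracket ℝ Y₁ X₁ p = 0)
    (h₁₂ : ∀ᶠ p in 𝓝 u₀, lieBracket ℝ Y₁ X₂ p = 0)
    (h₂₁ : ∀ᶠ p in 𝓝 u₀, lieBracket ℝ Y₂ X₁ p = 0)
    (h₂₂ : ∀ᶠ p in 𝓝 u₀, lieBracket ℝ Y₂ X₂ p = 0)
    (hYY : ∀ᶠ p in 𝓝 u₀, lieBracket ℝ Y₁ Y₂ p ∈ Submodule.span ℝ {X₁ p, X₂ p}) :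
    HasIntegralMap (fun p => Submodule.span ℝ {Y₁ p, Y₂ p, X₁ p, X₂ p}) u₀ 4 := by
  have := FiniteDimensional.complete ℝ E
  have flow : ∀ Z : E → E, ContDiff ℝ ∞ Z → ∃ Φ, IsLocalFlow Z Φ u₀ := fun Z hZ => by
    obtain ⟨Φ, h1, h2, h3⟩ := exists_smooth_flow Z hZ u₀
    exact ⟨Φ, h1, h2, h3⟩
  have zero_mem : ∀ {V W : E → E} {D : E → Submodule ℝ E},
      (∀ᶠ p in 𝓝 u₀, lieBracket ℝ V W p = 0) → ∀ᶠ p in 𝓝 u₀, lieBracket ℝ V W p ∈ D p :=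
    fun h => h.mono fun p hp => hp ▸ Submodule.zero_mem _
  obtain ⟨Φ₁, hΦ₁⟩ := flow X₁ hX₁
  obtain ⟨Φ₂, hΦ₂⟩ := flow X₂ hX₂
  obtain ⟨Ψ₁, hΨ₁⟩ := flow Y₁ hY₁
  obtain ⟨Ψ₂, hΨ₂⟩ := flow Y₂ hY₂
  -- The fields are added in the order `X₂, X₁, Y₂, Y₁`, so that `[Y₁, Y₂]` is needed only modulo
  -- the span of `X₁` and `X₂`, which is already in place.
  have i1 := (hasIntegralMap_bot u₀).span_sup hΦ₂ (IsLocalFlow.preserves_bot _ _)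
  have i2 := i1.span_sup hΦ₁ (hΦ₁.preserves_span_sup hX₁ hX₂ (IsLocalFlow.preserves_bot _ _)
    (zero_mem hXX))
  have i3 := i2.span_sup hΨ₂ (hΨ₂.preserves_span_sup hY₂ hX₁
    (hΨ₂.preserves_span_sup hY₂ hX₂ (IsLocalFlow.preserves_bot _ _) (zero_mem h₂₂))
    (zero_mem h₂₁))
  have i4 := i3.span_sup hΨ₁ (hΨ₁.preserves_span_sup hY₁ hY₂ (hΨ₁.preserves_span_sup hY₁ hX₁
    (hΨ₁.preserves_span_sup hY₁ hX₂ (IsLocalFlow.preserves_bot _ _) (zero_mem h₁₂))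
    (zero_mem h₁₁)) (hYY.mono fun p hp => by
      rwa [sup_bot_eq, ← Submodule.span_union, singleton_union]))
  simpa only [sup_bot_eq, ← Submodule.span_union, singleton_union] using i4

end Frobenius

/-! ### Related vector fields, immersions and invariance in normed spaces -/

section Related

variable {E F : Type*} [NormedAddCommGroup E] [NormedSpace ℝ E]
  [NormedAddCommGroup F] [NormedSpace ℝ F]

/-- The derivative of the relation `dφ (η) = Z ∘ φ` between vector fields. -/
theorem fderiv_fderiv_apply_add_of_related {φ : F → E} {w : F} (hφ : ContDiffAt ℝ 2 φ w)
    {η : F → F} {Z : E → E} (hη : DifferentiableAt ℝ η w) (hZ : DifferentiableAt ℝ Z (φ w))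
    (h : ∀ᶠ v in 𝓝 w, fderiv ℝ φ v (η v) = Z (φ v)) (v : F) :
    fderiv ℝ (fderiv ℝ φ) w v (η w) + fderiv ℝ φ w (fderiv ℝ η w v) =
      fderiv ℝ Z (φ w) (fderiv ℝ φ w v) := by
  have hd : HasFDerivAt (fderiv ℝ φ) (fderiv ℝ (fderiv ℝ φ) w) w :=
    ((hφ.fderiv_right (m := 1) (by norm_num)).differentiableAt (by simp)).hasFDerivAt
  have h1 := hd.clm_apply hη.hasFDerivAt
  have h2 : HasFDerivAt (fun v => fderiv ℝ φ v (η v)) (fderiv ℝ Z (φ w) ∘L fderiv ℝ φ w) w :=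
    (hZ.hasFDerivAt.comp w (hφ.differentiableAt (by simp)).hasFDerivAt).congr_of_eventuallyEq h
  have h3 := DFunLike.congr_fun (h1.unique h2) v
  rw [add_comm]
  exact h3

/-- The Lie brackets of related vector fields are related. -/
theorem fderiv_lieBracket_of_related {φ : F → E} {w : F} (hφ : ContDiffAt ℝ 2 φ w)
    {η₁ η₂ : F → F} {Z₁ Z₂ : E → E} (hη₁ : DifferentiableAt ℝ η₁ w)
    (hη₂ : DifferentiableAt ℝ η₂ w) (hZ₁ : DifferentiableAt ℝ Z₁ (φ w))
    (hZ₂ : DifferentiableAt ℝ Z₂ (φ w))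
    (h₁ : ∀ᶠ v in 𝓝 w, fderiv ℝ φ v (η₁ v) = Z₁ (φ v))
    (h₂ : ∀ᶠ v in 𝓝 w, fderiv ℝ φ v (η₂ v) = Z₂ (φ v)) :
    fderiv ℝ φ w (lieBracket ℝ η₁ η₂ w) = lieBracket ℝ Z₁ Z₂ (φ w) := by
  have e₁ := fderiv_fderiv_apply_add_of_related hφ hη₁ hZ₁ h₁ (η₂ w)
  have e₂ := fderiv_fderiv_apply_add_of_related hφ hη₂ hZ₂ h₂ (η₁ w)
  rw [h₂.self_of_nhds] at e₁
  rw [h₁.self_of_nhds] at e₂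
  have hs := (hφ.isSymmSndFDerivAt (by simp)) (η₁ w) (η₂ w)
  simp only [lieBracket, map_sub]
  rw [← e₁, ← e₂, hs]
  abel

/-- A vector field tangent to an immersion lifts to its domain. -/
theorem exists_related_of_mem_range [FiniteDimensional ℝ E] [FiniteDimensional ℝ F] {φ : F → E}
    {w : F} (hφ : ContDiffAt ℝ 2 φ w) (hinj : Function.Injective (fderiv ℝ φ w)) {Z : E → E}
    (hZ : DifferentiableAt ℝ Z (φ w))
    (h : ∀ᶠ v in 𝓝 w, Z (φ v) ∈ (fderiv ℝ φ v).toLinearMap.range) :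
    ∃ η : F → F, DifferentiableAt ℝ η w ∧ ∀ᶠ v in 𝓝 w, fderiv ℝ φ v (η v) = Z (φ v) := by
  have := FiniteDimensional.complete ℝ F
  -- A left inverse `L` of the derivative at `w` keeps `L ∘ dφ` invertible nearby, so the lift is
  -- given by the differentiable formula `(L ∘ dφ)⁻¹ L Z`.
  obtain ⟨l, hl⟩ := LinearMap.exists_leftInverse_of_injective (fderiv ℝ φ w).toLinearMap
    (LinearMap.ker_eq_bot.2 hinj)
  let L : E →L[ℝ] F := l.toContinuousLinearMap
  have hL : L ∘L fderiv ℝ φ w = ContinuousLinearMap.id ℝ F :=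
    ContinuousLinearMap.ext fun v => DFunLike.congr_fun hl v
  have hd : DifferentiableAt ℝ (fun v => L ∘L fderiv ℝ φ v) w :=
    (differentiableAt_const L).clm_comp
      ((hφ.fderiv_right (m := 1) (by norm_num)).differentiableAt (by simp))
  have hinv : (L ∘L fderiv ℝ φ w).IsInvertible := hL ▸ ⟨.refl ℝ F, rfl⟩
  have hinv' : ∀ᶠ v in 𝓝 w, (L ∘L fderiv ℝ φ v).IsInvertible := by
    have h2 := (ContinuousLinearEquiv.refl ℝ F).nhds
    rw [ContinuousLinearEquiv.coe_refl, ← hL] at h2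
    filter_upwards [hd.continuousAt.preimage_mem_nhds h2] with v hv using hv
  refine ⟨fun v => (L ∘L fderiv ℝ φ v).inverse (L (Z (φ v))), ?_, ?_⟩
  · have h1 : ContDiffAt ℝ 1 ContinuousLinearMap.inverse (L ∘L fderiv ℝ φ w) :=
      hinv.contDiffAt_map_inverse
    have h2 := DifferentiableAt.comp (f := fun v => L ∘L fderiv ℝ φ v) w
      (h1.differentiableAt one_ne_zero) hd
    exact h2.clm_apply (L.differentiableAt.comp w
      (hZ.comp w (hφ.differentiableAt (by simp))))
  · filter_upwards [h, hinv'] with v hv hiv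
    obtain ⟨a, ha⟩ := hv
    have : (L ∘L fderiv ℝ φ v).inverse (L (Z (φ v))) = a :=
      (hiv.inverse_apply_eq).2 (by rw [← ha]; rfl)
    rw [this]
    exact ha

/-- The bracket of two vector fields tangent to an immersion is tangent to it. -/
theorem lieBracket_mem_range [FiniteDimensional ℝ E] [FiniteDimensional ℝ F] {φ : F → E}
    {w : F} (hφ : ContDiffAt ℝ 2 φ w) (hinj : Function.Injective (fderiv ℝ φ w)) {Z₁ Z₂ : E → E}
    (hZ₁ : DifferentiableAt ℝ Z₁ (φ w)) (hZ₂ : DifferentiableAt ℝ Z₂ (φ w))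
    (h₁ : ∀ᶠ v in 𝓝 w, Z₁ (φ v) ∈ (fderiv ℝ φ v).toLinearMap.range)
    (h₂ : ∀ᶠ v in 𝓝 w, Z₂ (φ v) ∈ (fderiv ℝ φ v).toLinearMap.range) :
    lieBracket ℝ Z₁ Z₂ (φ w) ∈ (fderiv ℝ φ w).toLinearMap.range := by
  obtain ⟨η₁, hη₁, h₁⟩ := exists_related_of_mem_range hφ hinj hZ₁ h₁
  obtain ⟨η₂, hη₂, h₂⟩ := exists_related_of_mem_range hφ hinj hZ₂ h₂
  exact ⟨_, fderiv_lieBracket_of_related hφ hη₁ hη₂ hZ₁ hZ₂ h₁ h₂⟩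

/-- An immersion is locally injective. -/
theorem exists_injOn_of_injective_fderiv [FiniteDimensional ℝ E] [FiniteDimensional ℝ F]
    {φ : F → E} {w : F} (hφ : ContDiffAt ℝ 1 φ w) (hinj : Function.Injective (fderiv ℝ φ w)) :
    ∃ s ∈ 𝓝 w, InjOn φ s := by
  have := FiniteDimensional.complete ℝ F
  obtain ⟨l, hl⟩ := LinearMap.exists_leftInverse_of_injective (fderiv ℝ φ w).toLinearMap
    (LinearMap.ker_eq_bot.2 hinj)
  let L : E →L[ℝ] F := l.toContinuousLinearMap
  have hL : L ∘L fderiv ℝ φ w = ContinuousLinearMap.id ℝ F :=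
    ContinuousLinearMap.ext fun v => DFunLike.congr_fun hl v
  -- The inverse function theorem makes `L ∘ φ` locally injective, hence also `φ`.
  have h1 : HasStrictFDerivAt (L ∘ φ) ((ContinuousLinearEquiv.refl ℝ F) : F →L[ℝ] F) w := by
    rw [ContinuousLinearEquiv.coe_refl, ← hL]
    exact L.hasStrictFDerivAt.comp w (hφ.hasStrictFDerivAt (by simp))
  refine ⟨(h1.toOpenPartialHomeomorph _).source,
    (h1.toOpenPartialHomeomorph _).open_source.mem_nhds h1.mem_toOpenPartialHomeomorph_source, ?_⟩
  intro a ha b hb hab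
  exact (h1.toOpenPartialHomeomorph _).injOn ha hb (congrArg L hab)

/-- A vector field that is invariant under a local flow commutes with its generator. -/
theorem lieBracket_eq_zero_of_invariant {ψ : ℝ × E → E} {u : E} (hψ : ContDiffAt ℝ 2 ψ (0, u))
    (hψ0 : ψ (0, u) = u) {X Z : E → E} (hZ : DifferentiableAt ℝ Z u)
    (hX : ∀ᶠ v in 𝓝 u, fderiv ℝ ψ (0, v) (1, 0) = X v)
    (hinv : ∀ᶠ t in 𝓝 (0 : ℝ), fderiv ℝ ψ (t, u) (0, Z u) = Z (ψ (t, u))) :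
    lieBracket ℝ X Z u = 0 := by
  have hd : HasFDerivAt (fderiv ℝ ψ) (fderiv ℝ (fderiv ℝ ψ) (0, u)) (0, u) :=
    ((hψ.fderiv_right (m := 1) (by norm_num)).differentiableAt (by simp)).hasFDerivAt
  have h1 : HasFDerivAt X ((ContinuousLinearMap.apply ℝ E ((1 : ℝ), (0 : E))) ∘L
      fderiv ℝ (fderiv ℝ ψ) (0, u) ∘L .inr ℝ ℝ E) u :=
    ((ContinuousLinearMap.apply ℝ E ((1 : ℝ), (0 : E))).hasFDerivAt.comp u
      (hd.comp u (hasFDerivAt_prodMk_right (𝕜 := ℝ) (0 : ℝ) u))).congr_of_eventuallyEq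
      (by filter_upwards [hX] with v hv using hv.symm)
  have hcurve : HasDerivAt (fun t : ℝ => (t, u)) (1, 0) 0 :=
    (hasDerivAt_id _).prodMk (hasDerivAt_const _ _)
  have h2 : HasDerivAt (fun t => fderiv ℝ ψ (t, u) (0, Z u))
      (fderiv ℝ (fderiv ℝ ψ) (0, u) (1, 0) (0, Z u)) 0 :=
    (ContinuousLinearMap.apply ℝ E ((0 : ℝ), Z u)).hasFDerivAt.comp_hasDerivAt 0
      (hd.comp_hasDerivAt (0 : ℝ) hcurve)
  have h3 : HasDerivAt (fun t => ψ (t, u)) (X u) 0 := by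
    rw [← hX.self_of_nhds]
    exact (hψ.differentiableAt (by simp)).hasFDerivAt.comp_hasDerivAt (0 : ℝ) hcurve
  have h4 : HasDerivAt (fun t => fderiv ℝ ψ (t, u) (0, Z u)) (fderiv ℝ Z u (X u)) 0 := by
    rw [← hψ0] at hZ
    have := hZ.hasFDerivAt.comp_hasDerivAt (0 : ℝ) h3
    rw [hψ0] at this
    exact this.congr_of_eventuallyEq hinv
  -- The mixed second derivative of `ψ` in the directions of time and `Z u` is computed twice: by
  -- invariance it is the derivative of `Z` along `X`, and by definition of the generator that of
  -- `X` along `Z`.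
  have hs := (hψ.isSymmSndFDerivAt (by simp)) (1, 0) (0, Z u)
  simp only [lieBracket]
  rw [h4.unique h2, hs, h1.fderiv]
  exact sub_self _

end Related

/-! ### Vector fields in a chart -/

section Charts

variable {n : ℕ} {M : Type*} [TopologicalSpace M] [ChartedSpace (EuclideanSpace ℝ (Fin n)) M]

/-- The expression of a vector field in the chart at `x`. -/
def chartField (x : M) (Z : VectorField n M) (u : EuclideanSpace ℝ (Fin n)) :
    EuclideanSpace ℝ (Fin n) :=
  mfderiv (𝓡 n) 𝓘(ℝ, EuclideanSpace ℝ (Fin n)) (extChartAt (𝓡 n) x)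
    ((extChartAt (𝓡 n) x).symm u) (Z ((extChartAt (𝓡 n) x).symm u))

theorem chartField_extChartAt {x y : M} (hy : y ∈ (extChartAt (𝓡 n) x).source)
    (Z : VectorField n M) :
    chartField x Z (extChartAt (𝓡 n) x y) =
      mfderiv (𝓡 n) 𝓘(ℝ, EuclideanSpace ℝ (Fin n)) (extChartAt (𝓡 n) x) y (Z y) := by
  rw [chartField, (extChartAt (𝓡 n) x).left_inv hy]

variable [IsManifold (𝓡 n) ∞ M]

theorem mdifferentiableAt_extChartAt_symm' {x : M} {u : EuclideanSpace ℝ (Fin n)}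
    (hu : u ∈ (extChartAt (𝓡 n) x).target) :
    MDifferentiableAt 𝓘(ℝ, EuclideanSpace ℝ (Fin n)) (𝓡 n) (extChartAt (𝓡 n) x).symm u :=
  ((contMDiffOn_extChartAt_symm (n := ∞) x).contMDiffAt
    ((isOpen_extChartAt_target x).mem_nhds hu)).mdifferentiableAt (by simp)

theorem mfderiv_symm_chartField {x : M} (Z : VectorField n M) {u : EuclideanSpace ℝ (Fin n)}
    (hu : u ∈ (extChartAt (𝓡 n) x).target) :
    mfderiv 𝓘(ℝ, EuclideanSpace ℝ (Fin n)) (𝓡 n) (extChartAt (𝓡 n) x).symm u (chartField x Z u) =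
      Z ((extChartAt (𝓡 n) x).symm u) := by
  have : IsManifold (𝓡 n) 1 M := .of_le (n := ∞) (by simp)
  have h := mfderivWithin_extChartAt_symm_comp_mfderiv_extChartAt (I := 𝓡 n) hu
  rw [ModelWithCorners.range_eq_univ, mfderivWithin_univ] at h
  exact DFunLike.congr_fun h (Z ((extChartAt (𝓡 n) x).symm u))

theorem fderiv_comp_extChartAt_symm {x : M} (Z : VectorField n M) {u : EuclideanSpace ℝ (Fin n)}
    (hu : u ∈ (extChartAt (𝓡 n) x).target) {F : Type*} [NormedAddCommGroup F] [NormedSpace ℝ F]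
    {g : M → F} (hg : MDifferentiableAt (𝓡 n) 𝓘(ℝ, F) g ((extChartAt (𝓡 n) x).symm u)) :
    fderiv ℝ (fun v => g ((extChartAt (𝓡 n) x).symm v)) u (chartField x Z u) =
      mfderiv (𝓡 n) 𝓘(ℝ, F) g ((extChartAt (𝓡 n) x).symm u) (Z ((extChartAt (𝓡 n) x).symm u)) := by
  rw [← mfderiv_eq_fderiv]
  have h := mfderiv_comp u hg (mdifferentiableAt_extChartAt_symm' hu)
  have h' := DFunLike.congr_fun h (chartField x Z u)
  refine Eq.trans h' ?_
  exact congrArg _ (mfderiv_symm_chartField Z hu)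

/-- Smoothness of a section is tested in the trivialization of the tangent bundle at `x`, which acts
on fibres as the derivative of the chart at `x`. -/
theorem VectorField.Smooth.contDiffOn_chartField {Z : VectorField n M} (hZ : Z.Smooth) (x : M) :
    ContDiffOn ℝ ∞ (chartField x Z) (extChartAt (𝓡 n) x).target := by
  have : IsManifold (𝓡 n) 1 M := .of_le (n := ∞) (by simp)
  have h1 : ContMDiffOn (𝓡 n) 𝓘(ℝ, EuclideanSpace ℝ (Fin n)) ∞
      (fun y => mfderiv (𝓡 n) 𝓘(ℝ, EuclideanSpace ℝ (Fin n)) (extChartAt (𝓡 n) x) y (Z y))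
      (chartAt (EuclideanSpace ℝ (Fin n)) x).source := by
    intro y hy
    have h2 := ((trivializationAt (EuclideanSpace ℝ (Fin n)) (TangentSpace (𝓡 n)) x
      ).contMDiffAt_section_iff (IB := 𝓡 n) (n := ∞) (s := Z) (x₀ := y) hy).1 (hZ y)
    refine (h2.congr_of_eventuallyEq ?_).contMDiffWithinAt
    filter_upwards [(chartAt (EuclideanSpace ℝ (Fin n)) x).open_source.mem_nhds hy] with z hz
    have h3 := TangentBundle.continuousLinearMapAt_trivializationAt (I := 𝓡 n) hz
    refine (DFunLike.congr_fun h3.symm (Z z)).trans ?_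
    exact Bundle.Trivialization.continuousLinearMapAt_apply_of_mem ℝ
      (trivializationAt (EuclideanSpace ℝ (Fin n)) (TangentSpace (𝓡 n)) x) hz (Z z)
  rw [← contMDiffOn_iff_contDiffOn]
  refine h1.comp (contMDiffOn_extChartAt_symm x) fun u hu => ?_
  have := (extChartAt (𝓡 n) x).map_target hu
  rwa [extChartAt_source] at this

end Charts

/-! ### Change of charts -/

section ChartChange

variable {n : ℕ} {M : Type*} [TopologicalSpace M] [ChartedSpace (EuclideanSpace ℝ (Fin n)) M]
  [IsManifold (𝓡 n) ∞ M]

theorem VectorField.Smooth.contDiffAt_chartField {Z : VectorField n M} (hZ : Z.Smooth) {x : M}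
    {u : EuclideanSpace ℝ (Fin n)} (hu : u ∈ (extChartAt (𝓡 n) x).target) :
    ContDiffAt ℝ ∞ (chartField x Z) u :=
  (hZ.contDiffOn_chartField x).contDiffAt ((isOpen_extChartAt_target x).mem_nhds hu)

theorem VectorField.Smooth.differentiableAt_chartField {Z : VectorField n M} (hZ : Z.Smooth)
    {x : M} {u : EuclideanSpace ℝ (Fin n)} (hu : u ∈ (extChartAt (𝓡 n) x).target) :
    DifferentiableAt ℝ (chartField x Z) u :=
  (hZ.contDiffAt_chartField hu).differentiableAt (by simp)

/-- The tangent space at `x` is modelled on the preferred chart at `x`, whose derivative there is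
the identity. So coordinate expressions at the centre of the chart are tangent vectors. -/
theorem chartField_extChartAt_self (x : M) (Z : VectorField n M) :
    chartField x Z (extChartAt (𝓡 n) x x) = Z x := by
  have : IsManifold (𝓡 n) 1 M := .of_le (n := ∞) (by simp)
  rw [chartField_extChartAt (mem_extChartAt_source x)]
  exact DFunLike.congr_fun (mfderiv_extChartAt_self (I := 𝓡 n) (x := x)) (Z x)

theorem contDiffAt_comp_extChartAt_symm {x : M} {u : EuclideanSpace ℝ (Fin n)}
    (hu : u ∈ (extChartAt (𝓡 n) x).target) {F : Type*} [NormedAddCommGroup F] [NormedSpace ℝ F]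
    {g : M → F} (hg : ContMDiffAt (𝓡 n) 𝓘(ℝ, F) ∞ g ((extChartAt (𝓡 n) x).symm u)) :
    ContDiffAt ℝ ∞ (fun v => g ((extChartAt (𝓡 n) x).symm v)) u := by
  rw [← contMDiffAt_iff_contDiffAt]
  exact hg.comp u ((contMDiffOn_extChartAt_symm (n := ∞) x).contMDiffAt
    ((isOpen_extChartAt_target x).mem_nhds hu))

theorem contMDiffAt_extChartAt_of_mem_source {x y : M} (hy : y ∈ (extChartAt (𝓡 n) x).source) :
    ContMDiffAt (𝓡 n) 𝓘(ℝ, EuclideanSpace ℝ (Fin n)) ∞ (extChartAt (𝓡 n) x) y :=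
  contMDiffAt_extChartAt' (by rwa [extChartAt_source] at hy)

/-- Membership of the bracket of `Z₁`, `Z₂` in the span of `X₁`, `X₂` does not depend on the
chart. -/
theorem lieBracket_chartField_mem_span {X₁ X₂ Z₁ Z₂ : VectorField n M} (hZ₁ : Z₁.Smooth)
    (hZ₂ : Z₂.Smooth) {x y : M} (hy : y ∈ (extChartAt (𝓡 n) x).source)
    (h : lieBracket ℝ (chartField y Z₁) (chartField y Z₂) (extChartAt (𝓡 n) y y) ∈
      Submodule.span ℝ {chartField y X₁ (extChartAt (𝓡 n) y y),
        chartField y X₂ (extChartAt (𝓡 n) y y)}) :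
    lieBracket ℝ (chartField x Z₁) (chartField x Z₂) (extChartAt (𝓡 n) x y) ∈
      Submodule.span ℝ {chartField x X₁ (extChartAt (𝓡 n) x y),
        chartField x X₂ (extChartAt (𝓡 n) x y)} := by
  set w := extChartAt (𝓡 n) y y
  set κ : EuclideanSpace ℝ (Fin n) → EuclideanSpace ℝ (Fin n) :=
    fun v => extChartAt (𝓡 n) x ((extChartAt (𝓡 n) y).symm v) with hκ
  have hw : w ∈ (extChartAt (𝓡 n) y).target := mem_extChartAt_target y
  have hyw : (extChartAt (𝓡 n) y).symm w = y := extChartAt_to_inv y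
  have hκw : κ w = extChartAt (𝓡 n) x y := by rw [hκ]; simp only [hyw]
  have hev : ∀ᶠ v in 𝓝 w, v ∈ (extChartAt (𝓡 n) y).target ∧
      (extChartAt (𝓡 n) y).symm v ∈ (extChartAt (𝓡 n) x).source := by
    have h1 : ∀ᶠ v in 𝓝 w, v ∈ (extChartAt (𝓡 n) y).target := extChartAt_target_mem_nhds y
    refine h1.and ?_
    refine (continuousAt_extChartAt_symm y).preimage_mem_nhds ?_
    rw [hyw]
    exact (isOpen_extChartAt_source x).mem_nhds hy
  -- The transition map relates the two coordinate expressions of any field, hence also their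
  -- brackets.
  have hrel : ∀ Z : VectorField n M, ∀ᶠ v in 𝓝 w,
      fderiv ℝ κ v (chartField y Z v) = chartField x Z (κ v) := by
    intro Z
    filter_upwards [hev] with v hv
    rw [hκ, chartField_extChartAt hv.2]
    exact fderiv_comp_extChartAt_symm Z hv.1
      ((contMDiffAt_extChartAt_of_mem_source hv.2).mdifferentiableAt (by simp))
  have hκs : ContDiffAt ℝ ∞ κ w := contDiffAt_comp_extChartAt_symm hw
    (contMDiffAt_extChartAt_of_mem_source (by rwa [hyw]))
  have hκt : κ w ∈ (extChartAt (𝓡 n) x).target := hκw ▸ (extChartAt (𝓡 n) x).map_source hy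
  have hb := fderiv_lieBracket_of_related (hκs.of_le ENat.LEInfty.out)
    (hZ₁.differentiableAt_chartField hw) (hZ₂.differentiableAt_chartField hw)
    (hZ₁.differentiableAt_chartField hκt) (hZ₂.differentiableAt_chartField hκt)
    (hrel Z₁) (hrel Z₂)
  have h' := Submodule.mem_map_of_mem (f := (fderiv ℝ κ w).toLinearMap) h
  rw [Submodule.map_span, image_pair] at h'
  simp only [ContinuousLinearMap.coe_coe, hb, (hrel X₁).self_of_nhds, (hrel X₂).self_of_nhds,
    hκw] at h'
  exact h'

end ChartChange

/-! ### Invariant fields commute with the generators -/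

section Commutation

variable {n : ℕ} {M : Type*} [TopologicalSpace M] [ChartedSpace (EuclideanSpace ℝ (Fin n)) M]
  [IsManifold (𝓡 n) ∞ M] [MulAction (Circle × Circle) M]
  [ContMDiffSMul ((𝓡 1).prod (𝓡 1)) (𝓡 n) ∞ (Circle × Circle) M]

/-- The generator of a curve in the torus commutes with the invariant vector fields. -/
theorem lieBracket_chartField_eq_zero {X Z : VectorField n M} {c : ℝ → Circle × Circle}
    (hc : ContMDiff 𝓘(ℝ, ℝ) ((𝓡 1).prod (𝓡 1)) ∞ c) (hc0 : c 0 = 1)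
    (hX : ∀ x : M, IsMIntegralCurve (I := 𝓡 n) (fun t => c t • x) X) (hZ : Z.Smooth)
    (hinv : InvariantVectorField Z) {x : M} {u : EuclideanSpace ℝ (Fin n)}
    (hu : u ∈ (extChartAt (𝓡 n) x).target) :
    lieBracket ℝ (chartField x X) (chartField x Z) u = 0 := by
  set e := extChartAt (𝓡 n) x with he
  -- The action of the curve `c`, read in the chart: a local flow with generator `X`.
  set ψ : ℝ × EuclideanSpace ℝ (Fin n) → EuclideanSpace ℝ (Fin n) :=
    fun z => e (c z.1 • e.symm z.2) with hψ
  have hψs : ∀ t, ∀ v ∈ e.target, c t • e.symm v ∈ e.source → ContDiffAt ℝ ∞ ψ (t, v) := by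
    intro t v hv hs
    rw [← contMDiffAt_iff_contDiffAt]
    have h1 : ContMDiffAt 𝓘(ℝ, ℝ × EuclideanSpace ℝ (Fin n)) ((𝓡 1).prod (𝓡 1)) ∞
        (fun z : ℝ × EuclideanSpace ℝ (Fin n) => c z.1) (t, v) :=
      (hc.comp contDiff_fst.contMDiff) (t, v)
    have h2 : ContMDiffAt 𝓘(ℝ, ℝ × EuclideanSpace ℝ (Fin n)) (𝓡 n) ∞
        (fun z : ℝ × EuclideanSpace ℝ (Fin n) => e.symm z.2) (t, v) :=
      ContMDiffAt.comp (t, v) ((contMDiffOn_extChartAt_symm (n := ∞) x).contMDiffAt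
        ((isOpen_extChartAt_target x).mem_nhds hv)) contDiff_snd.contMDiff.contMDiffAt
    have h3 := h1.smul h2
    exact ContMDiffAt.comp (t, v) (contMDiffAt_extChartAt_of_mem_source hs) h3
  have hsrc : ∀ v ∈ e.target, c 0 • e.symm v ∈ e.source := fun v hv => by
    rw [hc0, one_smul]
    exact e.map_target hv
  have htarget : ∀ᶠ v in 𝓝 u, v ∈ e.target := (isOpen_extChartAt_target x).mem_nhds hu
  refine lieBracket_eq_zero_of_invariant ((hψs 0 u hu (hsrc u hu)).of_le ENat.LEInfty.out) ?_
    (hZ.differentiableAt_chartField hu) ?_ ?_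
  · simp only [hψ, hc0, one_smul]
    exact e.right_inv hu
  · filter_upwards [htarget] with v hv
    have hcurve : HasDerivAt (fun t : ℝ => (t, v)) (1, 0) 0 :=
      (hasDerivAt_id _).prodMk (hasDerivAt_const _ _)
    have h1 := ((hψs 0 v hv (hsrc v hv)).differentiableAt
      (by simp)).hasFDerivAt.comp_hasDerivAt (0 : ℝ) hcurve
    let A : EuclideanSpace ℝ (Fin n) →L[ℝ] EuclideanSpace ℝ (Fin n) :=
      mfderiv (𝓡 n) 𝓘(ℝ, EuclideanSpace ℝ (Fin n)) e (c 0 • e.symm v)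
    let ξ : EuclideanSpace ℝ (Fin n) := X (c 0 • e.symm v)
    have h2 : HasFDerivAt (fun t => e (c t • e.symm v)) (A ∘L (1 : ℝ →L[ℝ] ℝ).smulRight ξ) 0 :=
      (((contMDiffAt_extChartAt_of_mem_source (hsrc v hv)).mdifferentiableAt
        (by simp)).hasMFDerivAt.comp (0 : ℝ) (hX (e.symm v) 0)).hasFDerivAt
    have h3 : c 0 • e.symm v = e.symm v := by rw [hc0, one_smul]
    have h4 : A ξ = chartField x X v := by
      simp only [A, ξ, chartField]
      rw [h3]
      rfl
    refine (h1.unique h2.hasDerivAt).trans ?_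
    rw [← h4]
    simp
  · have hcont : Tendsto (fun t => c t • e.symm u) (𝓝 0) (𝓝 (c 0 • e.symm u)) :=
      (hX (e.symm u) 0).continuousAt
    filter_upwards [hcont.eventually ((isOpen_extChartAt_source x).mem_nhds (hsrc u hu))] with t ht
    have h1 := ((hψs t u hu ht).differentiableAt (by simp)).hasFDerivAt.comp u
      (hasFDerivAt_prodMk_right (𝕜 := ℝ) t u)
    have hact : MDifferentiableAt (𝓡 n) (𝓡 n) (fun y : M => c t • y) (e.symm u) :=
      (ContMDiffSMul.contMDiff_const_smul (I := (𝓡 1).prod (𝓡 1)) (n := ∞) (c t)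
        |>.contMDiffAt).mdifferentiableAt (by simp)
    have hmd : MDifferentiableAt (𝓡 n) 𝓘(ℝ, EuclideanSpace ℝ (Fin n)) e (c t • e.symm u) :=
      (contMDiffAt_extChartAt_of_mem_source ht).mdifferentiableAt (by simp)
    have h2 := fderiv_comp_extChartAt_symm Z hu (g := fun y => e (c t • y)) (hmd.comp _ hact)
    have h3 := DFunLike.congr_fun h1.fderiv (chartField x Z u)
    refine h3.symm.trans (h2.trans ?_)
    have h4 := DFunLike.congr_fun (mfderiv_comp (e.symm u) hmd hact) (Z (e.symm u))
    refine h4.trans ?_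
    rw [chartField_extChartAt ht]
    exact congrArg _ (hinv (c t) (e.symm u))

end Commutation

/-! ### The Schouten bracket of `π` in coordinates -/

section Bracket

variable {n : ℕ} {M : Type*} [TopologicalSpace M] [ChartedSpace (EuclideanSpace ℝ (Fin n)) M]

theorem bracket_wedge_add_wedge (Y₁ X₁ Y₂ X₂ : VectorField n M) (f g : M → ℝ) (y : M) :
    bracket (wedge Y₁ X₁ + wedge Y₂ X₂) f g y =
      differential n f y (Y₁ y) * differential n g y (X₁ y)
        - differential n f y (X₁ y) * differential n g y (Y₁ y)
        + (differential n f y (Y₂ y) * differential n g y (X₂ y)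
        - differential n f y (X₂ y) * differential n g y (Y₂ y)) := by
  simp only [bracket, wedge, Pi.add_apply, map_add]
  rw [exteriorPower.pairingDual_ιMulti_ιMulti, exteriorPower.pairingDual_ιMulti_ιMulti,
    Matrix.det_fin_two, Matrix.det_fin_two]
  simp
  ring

variable [IsManifold (𝓡 n) ∞ M]

/-- The differential of a function in terms of its expression in a chart. -/
theorem differential_apply_of_eventuallyEq {x y : M} (hy : y ∈ (extChartAt (𝓡 n) x).source)
    {f : M → ℝ} {G : EuclideanSpace ℝ (Fin n) → ℝ}
    (hG : DifferentiableAt ℝ G (extChartAt (𝓡 n) x y))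
    (hf : ∀ᶠ z in 𝓝 y, f z = G (extChartAt (𝓡 n) x z)) (Z : VectorField n M) :
    differential n f y (Z y) =
      fderiv ℝ G (extChartAt (𝓡 n) x y) (chartField x Z (extChartAt (𝓡 n) x y)) := by
  have h1 : mfderiv (𝓡 n) 𝓘(ℝ, ℝ) f y =
      mfderiv (𝓡 n) 𝓘(ℝ, ℝ) (G ∘ extChartAt (𝓡 n) x) y := Filter.EventuallyEq.mfderiv_eq hf
  have h2 := mfderiv_comp y hG.mdifferentiableAt
    ((contMDiffAt_extChartAt_of_mem_source hy).mdifferentiableAt (by simp))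
  rw [chartField_extChartAt hy]
  refine (DFunLike.congr_fun (h1.trans h2) (Z y)).trans ?_
  rw [mfderiv_eq_fderiv]
  rfl

/-- The expression of the bracket of two linear coordinates in a chart. -/
def chartBracket (x : M) (Y₁ X₁ Y₂ X₂ : VectorField n M)
    (α β : EuclideanSpace ℝ (Fin n) →L[ℝ] ℝ) (u : EuclideanSpace ℝ (Fin n)) : ℝ :=
  α (chartField x Y₁ u) * β (chartField x X₁ u) - α (chartField x X₁ u) * β (chartField x Y₁ u)
    + (α (chartField x Y₂ u) * β (chartField x X₂ u)
      - α (chartField x X₂ u) * β (chartField x Y₂ u))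

theorem differential_linearCoord {x y : M} (hy : y ∈ (extChartAt (𝓡 n) x).source)
    (α : EuclideanSpace ℝ (Fin n) →L[ℝ] ℝ) (Z : VectorField n M) :
    differential n (linearCoord x α.toLinearMap) y (Z y) =
      α (chartField x Z (extChartAt (𝓡 n) x y)) := by
  refine (differential_apply_of_eventuallyEq hy (G := α) α.differentiableAt
    (.of_forall fun z => rfl) Z).trans ?_
  rw [α.fderiv]

theorem bracket_linearCoord {x y : M} (hy : y ∈ (extChartAt (𝓡 n) x).source)
    (Y₁ X₁ Y₂ X₂ : VectorField n M) (α β : EuclideanSpace ℝ (Fin n) →L[ℝ] ℝ) :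
    bracket (wedge Y₁ X₁ + wedge Y₂ X₂) (linearCoord x α.toLinearMap)
      (linearCoord x β.toLinearMap) y =
      chartBracket x Y₁ X₁ Y₂ X₂ α β (extChartAt (𝓡 n) x y) := by
  simp only [bracket_wedge_add_wedge, differential_linearCoord hy, chartBracket]

variable {Y₁ X₁ Y₂ X₂ : VectorField n M}

theorem hasFDerivAt_chartBracket (hY₁ : Y₁.Smooth) (hX₁ : X₁.Smooth) (hY₂ : Y₂.Smooth)
    (hX₂ : X₂.Smooth) {x : M} {u : EuclideanSpace ℝ (Fin n)}
    (hu : u ∈ (extChartAt (𝓡 n) x).target) (α β : EuclideanSpace ℝ (Fin n) →L[ℝ] ℝ) :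
    DifferentiableAt ℝ (chartBracket x Y₁ X₁ Y₂ X₂ α β) u ∧
      ∀ v, fderiv ℝ (chartBracket x Y₁ X₁ Y₂ X₂ α β) u v =
        α (fderiv ℝ (chartField x Y₁) u v) * β (chartField x X₁ u)
        + α (chartField x Y₁ u) * β (fderiv ℝ (chartField x X₁) u v)
        - (α (fderiv ℝ (chartField x X₁) u v) * β (chartField x Y₁ u)
        + α (chartField x X₁ u) * β (fderiv ℝ (chartField x Y₁) u v))
        + (α (fderiv ℝ (chartField x Y₂) u v) * β (chartField x X₂ u)
        + α (chartField x Y₂ u) * β (fderiv ℝ (chartField x X₂) u v)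
        - (α (fderiv ℝ (chartField x X₂) u v) * β (chartField x Y₂ u)
        + α (chartField x X₂ u) * β (fderiv ℝ (chartField x Y₂) u v))) := by
  have key : ∀ (γ : EuclideanSpace ℝ (Fin n) →L[ℝ] ℝ) {Z : VectorField n M}, Z.Smooth →
      HasFDerivAt (fun u => γ (chartField x Z u)) (γ ∘L fderiv ℝ (chartField x Z) u) u :=
    fun γ Z hZ => γ.hasFDerivAt.comp u (hZ.differentiableAt_chartField hu).hasFDerivAt
  have h := (((key α hY₁).mul (key β hX₁)).sub ((key α hX₁).mul (key β hY₁))).add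
    (((key α hY₂).mul (key β hX₂)).sub ((key α hX₂).mul (key β hY₂)))
  have h' : HasFDerivAt (chartBracket x Y₁ X₁ Y₂ X₂ α β) _ u := h
  refine ⟨h'.differentiableAt, fun v => ?_⟩
  rw [h'.fderiv]
  simp
  ring

theorem bracket_bracket_linearCoord (hY₁ : Y₁.Smooth) (hX₁ : X₁.Smooth) (hY₂ : Y₂.Smooth)
    (hX₂ : X₂.Smooth) (x : M) (α β γ : EuclideanSpace ℝ (Fin n) →L[ℝ] ℝ) :
    bracket (wedge Y₁ X₁ + wedge Y₂ X₂) (bracket (wedge Y₁ X₁ + wedge Y₂ X₂)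
      (linearCoord x α.toLinearMap) (linearCoord x β.toLinearMap))
      (linearCoord x γ.toLinearMap) x =
      let u := extChartAt (𝓡 n) x x
      let D := fderiv ℝ (chartBracket x Y₁ X₁ Y₂ X₂ α β) u
      D (chartField x Y₁ u) * γ (chartField x X₁ u) - D (chartField x X₁ u) * γ (chartField x Y₁ u)
        + (D (chartField x Y₂ u) * γ (chartField x X₂ u)
          - D (chartField x X₂ u) * γ (chartField x Y₂ u)) := by
  have hx := mem_extChartAt_source (I := 𝓡 n) x
  have h : ∀ Z : VectorField n M, differential n (bracket (wedge Y₁ X₁ + wedge Y₂ X₂)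
      (linearCoord x α.toLinearMap) (linearCoord x β.toLinearMap)) x (Z x) =
      fderiv ℝ (chartBracket x Y₁ X₁ Y₂ X₂ α β) (extChartAt (𝓡 n) x x)
        (chartField x Z (extChartAt (𝓡 n) x x)) :=
    differential_apply_of_eventuallyEq hx
      (hasFDerivAt_chartBracket hY₁ hX₁ hY₂ hX₂ (mem_extChartAt_target x) α β).1
      (by filter_upwards [extChartAt_source_mem_nhds (I := 𝓡 n) x] with z hz
          using bracket_linearCoord hz _ _ _ _ α β)
  rw [bracket_wedge_add_wedge]
  simp only [h, differential_linearCoord hx]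

/-- For commuting `X₁`, `X₂`, both commuting with `Y₁`, `Y₂`, the Schouten bracket of
`Y₁ ∧ X₁ + Y₂ ∧ X₂` with itself is a multiple of `[Y₁, Y₂] ∧ X₁ ∧ X₂`. -/
theorem schoutenBracket_self (hY₁ : Y₁.Smooth) (hX₁ : X₁.Smooth) (hY₂ : Y₂.Smooth)
    (hX₂ : X₂.Smooth) (x : M) {u : EuclideanSpace ℝ (Fin n)} (hu : u = extChartAt (𝓡 n) x x)
    (hXX : lieBracket ℝ (chartField x X₁) (chartField x X₂) u = 0)
    (h₁₁ : lieBracket ℝ (chartField x X₁) (chartField x Y₁) u = 0)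
    (h₁₂ : lieBracket ℝ (chartField x X₁) (chartField x Y₂) u = 0)
    (h₂₁ : lieBracket ℝ (chartField x X₂) (chartField x Y₁) u = 0)
    (h₂₂ : lieBracket ℝ (chartField x X₂) (chartField x Y₂) u = 0)
    (α β γ : EuclideanSpace ℝ (Fin n) →L[ℝ] ℝ) :
    schoutenBracket (wedge Y₁ X₁ + wedge Y₂ X₂) (wedge Y₁ X₁ + wedge Y₂ X₂) x
      α.toLinearMap β.toLinearMap γ.toLinearMap =
      -2 * (Matrix.of fun i j => (![α, β, γ] i)
        (![lieBracket ℝ (chartField x Y₁) (chartField x Y₂) u, chartField x X₁ u,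
          chartField x X₂ u] j)).det := by
  have hu' : u ∈ (extChartAt (𝓡 n) x).target := hu ▸ mem_extChartAt_target x
  have hb := bracket_bracket_linearCoord hY₁ hX₁ hY₂ hX₂ x
  simp only [← hu] at hb
  simp only [schoutenBracket]
  rw [hb α β γ, hb β γ α, hb γ α β]
  simp only [(hasFDerivAt_chartBracket hY₁ hX₁ hY₂ hX₂ hu' _ _).2]
  -- Each vanishing bracket becomes an equality of directional derivatives and serves as a rewrite
  -- rule; in the cyclic sum only the terms of `[Y₁, Y₂]` survive.
  simp only [lieBracket, sub_eq_zero] at hXX h₁₁ h₁₂ h₂₁ h₂₂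
  simp only [hXX, h₁₁, h₁₂, h₂₁, h₂₂, Matrix.det_fin_three, Matrix.of_apply, lieBracket]
  simp only [Matrix.cons_val_zero, Matrix.cons_val_one, Matrix.cons_val, map_sub]
  ring

end Bracket

/-! ### Vanishing of a decomposable trivector -/

section Determinant

variable {E : Type*} [NormedAddCommGroup E] [NormedSpace ℝ E] [FiniteDimensional ℝ E]

/-- For independent vectors, dual covectors make the matrix the identity. For dependent ones, the
coefficients of a relation lie in the kernel of every such matrix. -/
theorem det_eq_zero_iff_not_linearIndependent (v : Fin 3 → E) :
    (∀ α β γ : E →L[ℝ] ℝ, (Matrix.of fun i j => (![α, β, γ] i) (v j)).det = 0) ↔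
      ¬ LinearIndependent ℝ v := by
  constructor
  · intro h hv
    obtain ⟨l, hl⟩ := LinearMap.exists_leftInverse_of_injective
      (Fintype.linearCombination ℝ v)
      (LinearMap.ker_eq_bot.2 (linearIndependent_iff_injective_fintypeLinearCombination.1 hv))
    have hlv : ∀ j, l (v j) = Pi.single j 1 := by
      intro j
      have := DFunLike.congr_fun hl (Pi.single j 1)
      simpa using this
    let a : Fin 3 → E →L[ℝ] ℝ := fun i => (LinearMap.proj i ∘ₗ l).toContinuousLinearMap
    have h1 := h (a 0) (a 1) (a 2)
    have h2 : (Matrix.of fun i j => (![a 0, a 1, a 2] i) (v j)) = 1 := by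
      ext i j
      have h3 : ![a 0, a 1, a 2] i = a i := by fin_cases i <;> rfl
      rw [Matrix.of_apply, h3]
      change l (v j) i = _
      rw [hlv, Matrix.one_apply, Pi.single_apply]
    rw [h2, Matrix.det_one] at h1
    exact one_ne_zero h1
  · intro hv α β γ
    rw [Fintype.linearIndependent_iff] at hv
    push Not at hv
    obtain ⟨g, hg, i, hi⟩ := hv
    refine Matrix.exists_mulVec_eq_zero_iff.1 ⟨g, fun h => hi (congrFun h i), ?_⟩
    ext k
    have h1 := congrArg (![α, β, γ] k) hg
    rw [map_sum, map_zero] at h1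
    rw [Matrix.mulVec, Pi.zero_apply, ← h1, dotProduct]
    refine Finset.sum_congr rfl fun j _ => ?_
    rw [map_smul, smul_eq_mul, Matrix.of_apply, mul_comm]

/-- This is what confines the Poisson condition to `independenceSet`: where `v₁, v₂` are dependent,
both sides hold trivially. -/
theorem not_linearIndependent_cons_pair_iff {E : Type*} [AddCommGroup E] [Module ℝ E]
    (b v₁ v₂ : E) :
    ¬ LinearIndependent ℝ ![b, v₁, v₂] ↔
      (LinearIndependent ℝ ![v₁, v₂] → b ∈ Submodule.span ℝ {v₁, v₂}) := by
  have h : LinearIndependent ℝ ![b, v₁, v₂] ↔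
      LinearIndependent ℝ ![v₁, v₂] ∧ b ∉ Submodule.span ℝ (range ![v₁, v₂]) :=
    linearIndependent_finCons
  rw [h, Matrix.range_cons, Matrix.range_cons, Matrix.range_empty, union_empty, singleton_union]
  tauto

end Determinant

/-! ### The Poisson condition as a condition on `[Y₁, Y₂]` -/

section Poisson

variable {n : ℕ} {M : Type*} [TopologicalSpace M] [ChartedSpace (EuclideanSpace ℝ (Fin n)) M]
  [IsManifold (𝓡 n) ∞ M]

theorem contMDiff_differential_apply {f : M → ℝ} (hf : ContMDiff (𝓡 n) 𝓘(ℝ, ℝ) ∞ f)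
    {Z : VectorField n M} (hZ : Z.Smooth) :
    ContMDiff (𝓡 n) 𝓘(ℝ, ℝ) ∞ fun y => differential n f y (Z y) := by
  intro x
  set F : EuclideanSpace ℝ (Fin n) → ℝ := fun u =>
    fderiv ℝ (fun v => f ((extChartAt (𝓡 n) x).symm v)) u (chartField x Z u)
  have hF : ContDiffAt ℝ ∞ F (extChartAt (𝓡 n) x x) :=
    ((contDiffAt_comp_extChartAt_symm (mem_extChartAt_target x) (hf _)).fderiv_right
      (m := ∞) (by simp)).clm_apply (hZ.contDiffAt_chartField (mem_extChartAt_target x))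
  have h1 : ContMDiffAt (𝓡 n) 𝓘(ℝ, ℝ) ∞ (F ∘ extChartAt (𝓡 n) x) x :=
    hF.contMDiffAt.comp x (contMDiffAt_extChartAt_of_mem_source (mem_extChartAt_source x))
  refine h1.congr_of_eventuallyEq ?_
  filter_upwards [extChartAt_source_mem_nhds (I := 𝓡 n) x] with y hy
  have h2 := fderiv_comp_extChartAt_symm Z ((extChartAt (𝓡 n) x).map_source hy)
    ((hf _).mdifferentiableAt (by simp))
  refine Eq.trans ?_ h2.symm
  rw [(extChartAt (𝓡 n) x).left_inv hy]
  rfl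

/-- The bracket of two vector fields at `x`, computed in the chart at `x`. -/
def bracketAt (Z₁ Z₂ : VectorField n M) (x : M) : TangentSpace (𝓡 n) x :=
  lieBracket (E := EuclideanSpace ℝ (Fin n)) ℝ (chartField x Z₁) (chartField x Z₂)
    (extChartAt (𝓡 n) x x)

variable {Y₁ X₁ Y₂ X₂ : VectorField n M}

/-- The Schouten bracket evaluates on covectors to `-2` times the determinant of their values on
`[Y₁, Y₂], X₁, X₂`, so it vanishes at `x` exactly when these are dependent. Smoothness of `π` is
automatic from that of the four fields. -/
theorem isPoisson_iff_bracketAt_mem_span (hY₁ : Y₁.Smooth) (hX₁ : X₁.Smooth) (hY₂ : Y₂.Smooth)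
    (hX₂ : X₂.Smooth)
    (hXX : ∀ x : M, ∀ u ∈ (extChartAt (𝓡 n) x).target,
      lieBracket ℝ (chartField x X₁) (chartField x X₂) u = 0)
    (h₁₁ : ∀ x : M, ∀ u ∈ (extChartAt (𝓡 n) x).target,
      lieBracket ℝ (chartField x X₁) (chartField x Y₁) u = 0)
    (h₁₂ : ∀ x : M, ∀ u ∈ (extChartAt (𝓡 n) x).target,
      lieBracket ℝ (chartField x X₁) (chartField x Y₂) u = 0)
    (h₂₁ : ∀ x : M, ∀ u ∈ (extChartAt (𝓡 n) x).target,
      lieBracket ℝ (chartField x X₂) (chartField x Y₁) u = 0)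
    (h₂₂ : ∀ x : M, ∀ u ∈ (extChartAt (𝓡 n) x).target,
      lieBracket ℝ (chartField x X₂) (chartField x Y₂) u = 0) :
    IsPoisson (wedge Y₁ X₁ + wedge Y₂ X₂) ↔
      ∀ x ∈ independenceSet X₁ X₂, bracketAt Y₁ Y₂ x ∈ Submodule.span ℝ {X₁ x, X₂ x} := by
  have hsch : ∀ x : M, (∀ α β γ : Module.Dual ℝ (TangentSpace (𝓡 n) x),
      schoutenBracket (wedge Y₁ X₁ + wedge Y₂ X₂) (wedge Y₁ X₁ + wedge Y₂ X₂) x α β γ = 0) ↔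
      (x ∈ independenceSet X₁ X₂ → bracketAt Y₁ Y₂ x ∈ Submodule.span ℝ {X₁ x, X₂ x}) := by
    intro x
    have hx := mem_extChartAt_target (I := 𝓡 n) x
    have key := schoutenBracket_self hY₁ hX₁ hY₂ hX₂ x rfl (hXX x _ hx) (h₁₁ x _ hx)
      (h₁₂ x _ hx) (h₂₁ x _ hx) (h₂₂ x _ hx)
    simp only [chartField_extChartAt_self] at key
    have h1 := det_eq_zero_iff_not_linearIndependent (E := EuclideanSpace ℝ (Fin n))
      ![bracketAt Y₁ Y₂ x, X₁ x, X₂ x]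
    refine Iff.trans ?_ (h1.trans (not_linearIndependent_cons_pair_iff
      (E := EuclideanSpace ℝ (Fin n)) _ _ _))
    constructor
    · intro h α β γ
      have := (key α β γ).symm.trans (h α.toLinearMap β.toLinearMap γ.toLinearMap)
      simpa [bracketAt] using this
    · intro h α β γ
      let a : (EuclideanSpace ℝ (Fin n) →ₗ[ℝ] ℝ) → EuclideanSpace ℝ (Fin n) →L[ℝ] ℝ :=
        fun α => α.toContinuousLinearMap
      have := key (a α) (a β) (a γ)
      refine this.trans ?_
      have h2 := h (a α) (a β) (a γ)
      simp only [bracketAt] at h2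
      rw [h2, mul_zero]
  constructor
  · intro h x hx
    exact (hsch x).1 (h.schouten_self x) hx
  · intro h
    refine ⟨fun f g hf hg => ?_, fun x => (hsch x).2 (h x)⟩
    have h1 : bracket (wedge Y₁ X₁ + wedge Y₂ X₂) f g = _ :=
      funext fun y => bracket_wedge_add_wedge Y₁ X₁ Y₂ X₂ f g y
    rw [h1]
    have key := fun {f : M → ℝ} (hf : ContMDiff (𝓡 n) 𝓘(ℝ, ℝ) ∞ f) {Z : VectorField n M}
      (hZ : Z.Smooth) => contMDiff_differential_apply hf hZ
    exact (((key hf hY₁).mul (key hg hX₁)).sub ((key hf hX₁).mul (key hg hY₁))).add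
      (((key hf hY₂).mul (key hg hX₂)).sub ((key hf hX₂).mul (key hg hY₂)))

/-- A function whose derivatives along two vector fields are locally constant has vanishing
derivative along their bracket. -/
theorem differential_bracketAt_eq_zero (hY₁ : Y₁.Smooth) (hY₂ : Y₂.Smooth) {h : M → ℝ}
    (hh : ContMDiff (𝓡 n) 𝓘(ℝ, ℝ) ∞ h) {x : M} {c₁ c₂ : ℝ}
    (h₁ : ∀ᶠ y in 𝓝 x, differential n h y (Y₁ y) = c₁)
    (h₂ : ∀ᶠ y in 𝓝 x, differential n h y (Y₂ y) = c₂) :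
    differential n h x (bracketAt Y₁ Y₂ x) = 0 := by
  have hx := mem_extChartAt_target (I := 𝓡 n) x
  have hxx := extChartAt_to_inv (I := 𝓡 n) x
  set u := extChartAt (𝓡 n) x x with hu
  have hcont : Tendsto (extChartAt (𝓡 n) x).symm (𝓝 u) (𝓝 x) := by
    have := continuousAt_extChartAt_symm (I := 𝓡 n) x
    rwa [ContinuousAt, hxx] at this
  have hrel : ∀ (Z : VectorField n M) (c : ℝ), (∀ᶠ y in 𝓝 x, differential n h y (Z y) = c) →
      ∀ᶠ v in 𝓝 u, fderiv ℝ (fun v => h ((extChartAt (𝓡 n) x).symm v)) v (chartField x Z v) = c := by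
    intro Z c hc
    filter_upwards [(isOpen_extChartAt_target x).mem_nhds hx, hcont.eventually hc] with v hv hvc
    rw [← hvc]
    exact fderiv_comp_extChartAt_symm Z hv ((hh _).mdifferentiableAt (by simp))
  -- As a map to `ℝ`, the function `h` relates `Y₁, Y₂` to constant fields, whose bracket is zero.
  have key := fderiv_lieBracket_of_related (Z₁ := fun _ : ℝ => c₁) (Z₂ := fun _ : ℝ => c₂)
    ((contDiffAt_comp_extChartAt_symm hx (hh _)).of_le ENat.LEInfty.out)
    (hY₁.differentiableAt_chartField hx) (hY₂.differentiableAt_chartField hx)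
    (differentiableAt_const _) (differentiableAt_const _) (hrel Y₁ c₁ h₁) (hrel Y₂ c₂ h₂)
  rw [show lieBracket ℝ (fun _ : ℝ => c₁) (fun _ : ℝ => c₂)
    (h ((extChartAt (𝓡 n) x).symm u)) = 0 by simp [lieBracket]] at key
  let Z : VectorField n M := fun _ => bracketAt Y₁ Y₂ x
  have h3 := fderiv_comp_extChartAt_symm Z hx (g := h) ((hh _).mdifferentiableAt (by simp))
  rw [hxx, hu, chartField_extChartAt_self] at h3
  exact h3.symm.trans key

end Poisson

/-! ### Generators and orbit tangent spaces -/

section Generators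

variable {n : ℕ} {M : Type*} [TopologicalSpace M] [ChartedSpace (EuclideanSpace ℝ (Fin n)) M]
  [MulAction (Circle × Circle) M]

/-- A function invariant under the action is constant along the generators. -/
theorem differential_generator_eq_zero {h : M → ℝ} (hh : ContMDiff (𝓡 n) 𝓘(ℝ, ℝ) ∞ h)
    (hinv : InvariantFunction h) {X : VectorField n M} {c : ℝ → Circle × Circle} (hc0 : c 0 = 1)
    (hX : ∀ x : M, IsMIntegralCurve (I := 𝓡 n) (fun t => c t • x) X) (x : M) :
    differential n h x (X x) = 0 := by
  have hx : c 0 • x = x := by rw [hc0, one_smul]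
  have h1 := ((hh (c 0 • x)).mdifferentiableAt (by simp)).hasMFDerivAt.comp (0 : ℝ) (hX x 0)
  have h2 : HasMFDerivAt 𝓘(ℝ, ℝ) 𝓘(ℝ, ℝ) (fun _ : ℝ => h x) (0 : ℝ) 0 := hasMFDerivAt_const _ _
  have h3 : (h ∘ fun t => c t • x) = fun _ => h x := funext fun t => hinv (c t) x
  rw [h3] at h1
  have h4 := DFunLike.congr_fun (hasMFDerivAt_unique h1 h2) (1 : ℝ)
  have h5 : differential n h (c 0 • x) (X (c 0 • x)) = 0 := by
    refine Eq.trans ?_ h4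
    exact congrArg (differential n h (c 0 • x)) (one_smul ℝ (X (c 0 • x))).symm
  rwa [hx] at h5

variable [ContMDiffSMul ((𝓡 1).prod (𝓡 1)) (𝓡 n) ∞ (Circle × Circle) M]

/-- The generators of the torus action are invariant. -/
theorem invariantVectorField_generator {X : VectorField n M} {c : ℝ → Circle × Circle}
    (hc0 : c 0 = 1) (hX : ∀ x : M, IsMIntegralCurve (I := 𝓡 n) (fun t => c t • x) X) :
    InvariantVectorField X := by
  intro g x
  have hx : ∀ x : M, c 0 • x = x := fun x => by rw [hc0, one_smul]
  have hact : ∀ y, MDifferentiableAt (𝓡 n) (𝓡 n) (fun y : M => g • y) y := fun y =>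
    (ContMDiffSMul.contMDiff_const_smul (I := (𝓡 1).prod (𝓡 1)) (n := ∞) g
      |>.contMDiffAt).mdifferentiableAt (by simp)
  have h1 := (hact (c 0 • x)).hasMFDerivAt.comp (0 : ℝ) (hX x 0)
  have h2 := hX (g • x) 0
  -- The torus is abelian, so `g` carries the curve through `x` to the one through `g • x`.
  have h3 : ((fun y : M => g • y) ∘ fun t => c t • x) = fun t => c t • g • x :=
    funext fun t => smul_comm g (c t) x
  rw [h3] at h1
  have h4 := DFunLike.congr_fun (hasMFDerivAt_unique h1 h2) (1 : ℝ)
  have h5 : mfderiv (𝓡 n) (𝓡 n) (fun y : M => g • y) (c 0 • x) (X (c 0 • x)) =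
      X (c 0 • g • x) := by
    refine Eq.trans ?_ (h4.trans (one_smul ℝ (X (c 0 • g • x))))
    exact congrArg (mfderiv (𝓡 n) (𝓡 n) (fun y : M => g • y) (c 0 • x))
      (one_smul ℝ (X (c 0 • x))).symm
  rwa [hx, hx] at h5

theorem mfderiv_orbitMap_apply {X : VectorField n M} {c : ℝ → Circle × Circle}
    (hc0 : c 0 = 1) (hX : ∀ x : M, IsMIntegralCurve (I := 𝓡 n) (fun t => c t • x) X) (x : M)
    {L : ℝ →L[ℝ] EuclideanSpace ℝ (Fin 1) × EuclideanSpace ℝ (Fin 1)}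
    (hc : HasMFDerivAt 𝓘(ℝ, ℝ) ((𝓡 1).prod (𝓡 1)) c 0 L) :
    mfderiv ((𝓡 1).prod (𝓡 1)) (𝓡 n) (fun g : Circle × Circle => g • x) 1 (L 1) = X x := by
  have hsm : ContMDiff ((𝓡 1).prod (𝓡 1)) (𝓡 n) ∞ (fun g : Circle × Circle => g • x) :=
    ContMDiff.smul (I := (𝓡 1).prod (𝓡 1)) contMDiff_id contMDiff_const
  have h1 := (((hsm (c 0)).mdifferentiableAt (by simp)).hasMFDerivAt).comp (0 : ℝ) hc
  have h2 := DFunLike.congr_fun (hasMFDerivAt_unique h1 (hX x 0)) (1 : ℝ)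
  have h3 := congrArg (fun g => (mfderiv ((𝓡 1).prod (𝓡 1)) (𝓡 n)
    (fun g : Circle × Circle => g • x) g (L 1) : EuclideanSpace ℝ (Fin n))) hc0
  have h4 := congrArg (fun y : M => (X y : EuclideanSpace ℝ (Fin n)))
    (show c 0 • x = x by rw [hc0, one_smul])
  exact h3.symm.trans (h2.trans ((one_smul ℝ (X (c 0 • x))).trans h4))

/-- Included into `ℂ`, the velocity is `Complex.I`. The tangent space of the circle being a line,
this velocity spans it. -/
theorem mfderiv_circleExp_ne_zero :
    mfderiv 𝓘(ℝ, ℝ) (𝓡 1) Circle.exp (0 : ℝ) (1 : ℝ) ≠ 0 := by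
  intro h
  have := finrank_real_complex_fact'
  have hcoe : ContMDiff (𝓡 1) 𝓘(ℝ, ℂ) ∞ (fun z : Circle => (z : ℂ)) :=
    contMDiff_coe_sphere (E := ℂ)
  have h1 := ((hcoe (Circle.exp 0)).mdifferentiableAt (by simp)).hasMFDerivAt.comp (0 : ℝ)
    ((contMDiff_circleExp (m := ∞) 0).mdifferentiableAt (by simp)).hasMFDerivAt
  have h2 : HasDerivAt (fun t : ℝ => Complex.exp (t * Complex.I))
      (Complex.exp ((0 : ℝ) * Complex.I) * (1 * Complex.I)) (0 : ℝ) :=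
    ((Complex.ofRealCLM.hasDerivAt (x := (0 : ℝ))).mul_const Complex.I).cexp
  have h3 : (fun z : Circle => (z : ℂ)) ∘ Circle.exp = fun t : ℝ => Complex.exp (t * Complex.I) :=
    funext Circle.coe_exp
  rw [h3] at h1
  have h4 := DFunLike.congr_fun (hasMFDerivAt_unique h1 h2.hasFDerivAt.hasMFDerivAt) (1 : ℝ)
  let B : EuclideanSpace ℝ (Fin 1) →L[ℝ] ℂ :=
    mfderiv (𝓡 1) 𝓘(ℝ, ℂ) (fun z : Circle => (z : ℂ)) (Circle.exp 0)
  have h5 : B 0 = Complex.I := by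
    refine (congrArg B h).symm.trans (h4.trans ?_)
    change (1 : ℝ) • (Complex.exp ((0 : ℝ) * Complex.I) * (1 * Complex.I)) = _
    simp
  rw [map_zero] at h5
  exact Complex.I_ne_zero h5.symm

theorem range_eq_span_pair {E F : Type*} [NormedAddCommGroup E] [NormedSpace ℝ E]
    [NormedAddCommGroup F] [NormedSpace ℝ F] (hE : Module.finrank ℝ E = 1) (D : E × E →L[ℝ] F)
    {w : E} (hw : w ≠ 0) : D.toLinearMap.range = Submodule.span ℝ {D (w, 0), D (0, w)} := by
  have hspan : ∀ v : E, ∃ a : ℝ, a • w = v := exists_smul_eq_of_finrank_eq_one hE hw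
  apply le_antisymm
  · rintro _ ⟨⟨v₁, v₂⟩, rfl⟩
    obtain ⟨a, rfl⟩ := hspan v₁
    obtain ⟨b, rfl⟩ := hspan v₂
    refine Submodule.mem_span_pair.2 ⟨a, b, ?_⟩
    simp [← map_smul, ← map_add]
  · rw [Submodule.span_le]
    rintro _ (rfl | rfl)
    · exact ⟨(w, 0), rfl⟩
    · exact ⟨(0, w), rfl⟩

/-- The velocities of the two coordinate circles span the tangent space of the torus at the unit,
and the orbit map sends them to `X₁ x` and `X₂ x`. -/
theorem orbitTangent_eq_span {X₁ X₂ : VectorField n M} (hX : AreGenerators X₁ X₂) (x : M) :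
    orbitTangent n x = Submodule.span ℝ {X₁ x, X₂ x} := by
  let A : ℝ →L[ℝ] EuclideanSpace ℝ (Fin 1) := mfderiv 𝓘(ℝ, ℝ) (𝓡 1) Circle.exp (0 : ℝ)
  have hexp : HasMFDerivAt 𝓘(ℝ, ℝ) (𝓡 1) Circle.exp (0 : ℝ) A :=
    ((contMDiff_circleExp (m := ∞) 0).mdifferentiableAt (by simp)).hasMFDerivAt
  have hone : HasMFDerivAt 𝓘(ℝ, ℝ) (𝓡 1) (fun _ : ℝ => (1 : Circle)) (0 : ℝ)
      (0 : ℝ →L[ℝ] EuclideanSpace ℝ (Fin 1)) := hasMFDerivAt_const _ _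
  let D : EuclideanSpace ℝ (Fin 1) × EuclideanSpace ℝ (Fin 1) →L[ℝ] EuclideanSpace ℝ (Fin n) :=
    mfderiv ((𝓡 1).prod (𝓡 1)) (𝓡 n) (fun g : Circle × Circle => g • x) 1
  have h1 : D (A 1, 0) = X₁ x :=
    mfderiv_orbitMap_apply (c := fun t => (Circle.exp t, 1)) (L := A.prod 0) (by simp)
      (fun y => (hX y).1) x (hexp.prodMk hone)
  have h2 : D (0, A 1) = X₂ x :=
    mfderiv_orbitMap_apply (c := fun t => (1, Circle.exp t)) (L := .prod 0 A) (by simp)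
      (fun y => (hX y).2) x (hone.prodMk hexp)
  have h3 := range_eq_span_pair (by simp) D (w := A 1) mfderiv_circleExp_ne_zero
  rw [h1, h2] at h3
  exact h3

end Generators

/-! ### Linear algebra of compatibility, with `a₁, a₂` in the role of `dh₁, dh₂` -/

section LinearAlgebra

variable {V : Type*} [AddCommGroup V] [Module ℝ V] {X₁ X₂ Y₁ Y₂ : V} {a₁ a₂ : Module.Dual ℝ V}

theorem linearIndependent_four (hX : LinearIndependent ℝ ![X₁, X₂]) (h₁₁ : a₁ Y₁ = 1)
    (h₁₂ : a₁ Y₂ = 0) (h₂₁ : a₂ Y₁ = 0) (h₂₂ : a₂ Y₂ = 1) (x₁₁ : a₁ X₁ = 0) (x₁₂ : a₁ X₂ = 0)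
    (x₂₁ : a₂ X₁ = 0) (x₂₂ : a₂ X₂ = 0) : LinearIndependent ℝ ![Y₁, Y₂, X₁, X₂] := by
  rw [Fintype.linearIndependent_iff]
  intro g hg
  simp only [Fin.sum_univ_four, Matrix.cons_val_zero, Matrix.cons_val_one, Matrix.cons_val] at hg
  have h1 := congrArg a₁ hg
  have h2 := congrArg a₂ hg
  simp [h₁₁, h₁₂, h₂₁, h₂₂, x₁₁, x₁₂, x₂₁, x₂₂] at h1 h2
  rw [h1, h2, zero_smul, zero_smul, zero_add, zero_add] at hg
  have h3 := LinearIndependent.pair_iff.1 hX _ _ hg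
  intro i
  fin_cases i
  exacts [h1, h2, h3.1, h3.2]

theorem span_four_sup_ker_eq_top (h₁₁ : a₁ Y₁ = 1) (h₁₂ : a₁ Y₂ = 0) (h₂₁ : a₂ Y₁ = 0)
    (h₂₂ : a₂ Y₂ = 1) :
    Submodule.span ℝ {Y₁, Y₂, X₁, X₂} ⊔ (a₁.ker ⊓ a₂.ker) = ⊤ := by
  rw [eq_top_iff]
  intro v _
  -- As `a₁, a₂` are dual to `Y₁, Y₂`, the remainder is killed by both.
  have h : v = (a₁ v • Y₁ + a₂ v • Y₂) + (v - (a₁ v • Y₁ + a₂ v • Y₂)) := by abel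
  rw [h]
  refine Submodule.add_mem_sup (Submodule.add_mem _ (Submodule.smul_mem _ _
    (Submodule.subset_span (by simp))) (Submodule.smul_mem _ _
    (Submodule.subset_span (by simp)))) ⟨?_, ?_⟩ <;>
  simp [h₁₁, h₁₂, h₂₁, h₂₂]

theorem span_pair_eq_span_four_inf_ker (h₁₁ : a₁ Y₁ = 1)
    (h₁₂ : a₁ Y₂ = 0) (h₂₁ : a₂ Y₁ = 0) (h₂₂ : a₂ Y₂ = 1) (x₁₁ : a₁ X₁ = 0) (x₁₂ : a₁ X₂ = 0)
    (x₂₁ : a₂ X₁ = 0) (x₂₂ : a₂ X₂ = 0) :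
    Submodule.span ℝ {X₁, X₂} = Submodule.span ℝ {Y₁, Y₂, X₁, X₂} ⊓ (a₁.ker ⊓ a₂.ker) := by
  apply le_antisymm
  · refine le_inf (Submodule.span_mono (by intro v hv; simp at hv ⊢; tauto)) ?_
    rw [Submodule.span_le]
    rintro _ (rfl | rfl)
    · exact ⟨x₁₁, x₂₁⟩
    · exact ⟨x₁₂, x₂₂⟩
  · intro v hv
    obtain ⟨hv, hv₁, hv₂⟩ : v ∈ Submodule.span ℝ {Y₁, Y₂, X₁, X₂} ∧ a₁ v = 0 ∧ a₂ v = 0 := hv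
    obtain ⟨b₁, w, hw, hvw⟩ := Submodule.mem_span_insert.1 hv
    obtain ⟨b₂, w', hw', hww'⟩ := Submodule.mem_span_insert.1 hw
    obtain ⟨c, d, hcd⟩ := Submodule.mem_span_pair.1 hw'
    rw [hvw, hww', ← hcd] at hv₁ hv₂
    simp only [map_add, map_smul, smul_eq_mul, h₁₁, h₁₂, h₂₁, h₂₂, x₁₁, x₁₂, x₂₁, x₂₂, mul_one,
      mul_zero, add_zero, zero_add] at hv₁ hv₂
    rw [hvw, hww', hv₁, hv₂, zero_smul, zero_smul, zero_add, zero_add]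
    exact hw'

theorem map_span_four {W : Type*} [AddCommGroup W] [Module ℝ W] (L : V →ₗ[ℝ] W)
    {Z₁ Z₂ Z₃ Z₄ : V} {Z₁' Z₂' Z₃' Z₄' : W} (h₁ : L Z₁ = Z₁') (h₂ : L Z₂ = Z₂')
    (h₃ : L Z₃ = Z₃') (h₄ : L Z₄ = Z₄') :
    (Submodule.span ℝ {Z₁, Z₂, Z₃, Z₄}).map L = Submodule.span ℝ {Z₁', Z₂', Z₃', Z₄'} := by
  rw [Submodule.map_span, image_insert_eq, image_insert_eq, image_insert_eq, image_singleton, h₁,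
    h₂, h₃, h₄]

end LinearAlgebra

/-! ### Cutoffs and openness of `U` -/

section Extension

/-- A smooth map on an open set agrees near each point with a globally smooth one. -/
theorem exists_contDiff_eventuallyEq {E F : Type*} [NormedAddCommGroup E] [NormedSpace ℝ E]
    [FiniteDimensional ℝ E] [NormedAddCommGroup F] [NormedSpace ℝ F] {f : E → F} {T : Set E}
    (hT : IsOpen T) (hf : ContDiffOn ℝ ∞ f T) {u : E} (hu : u ∈ T) :
    ∃ g : E → F, ContDiff ℝ ∞ g ∧ g =ᶠ[𝓝 u] f := by
  obtain ⟨r, hr, hrT⟩ := Metric.isOpen_iff.1 hT u hu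
  let χ : ContDiffBump u := ⟨r / 4, r / 2, by positivity, by linarith⟩
  refine ⟨fun y => χ y • f y, contDiff_iff_contDiffAt.2 fun y => ?_, ?_⟩
  · by_cases hy : y ∈ T
    · exact χ.contDiffAt.smul (hf.contDiffAt (hT.mem_nhds hy))
    · have hy' : y ∉ tsupport χ := by
        rw [χ.tsupport_eq]
        intro h
        exact hy (hrT (Metric.closedBall_subset_ball (by change r / 2 < r; linarith) h))
      have h0 : (fun y => χ y • f y) =ᶠ[𝓝 y] fun _ => 0 := by
        filter_upwards [notMem_tsupport_iff_eventuallyEq.1 hy'] with z hz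
        rw [hz, Pi.zero_apply, zero_smul]
      exact contDiffAt_const.congr_of_eventuallyEq h0
  · filter_upwards [χ.eventuallyEq_one] with y hy
    rw [hy, Pi.one_apply, one_smul]

variable {n : ℕ} {M : Type*} [TopologicalSpace M] [ChartedSpace (EuclideanSpace ℝ (Fin n)) M]
  [IsManifold (𝓡 n) ∞ M]

theorem VectorField.Smooth.smul_add_smul {Z₁ Z₂ : VectorField n M} (hZ₁ : Z₁.Smooth)
    (hZ₂ : Z₂.Smooth) (a b : ℝ) : VectorField.Smooth (a • Z₁ + b • Z₂) :=
  (ContMDiff.const_smul_section hZ₁).add_section (ContMDiff.const_smul_section hZ₂)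

/-- A smooth vector field can be cut off outside a neighbourhood of a point. -/
theorem exists_smooth_smul_eq [T2Space M] {U : Set M} (hU : IsOpen U) {x : M} (hx : x ∈ U)
    {Z : VectorField n M} (hZ : Z.Smooth) :
    ∃ Z' : VectorField n M, Z'.Smooth ∧ Z' x = Z x ∧ (∀ y, ∃ r : ℝ, Z' y = r • Z y) ∧
      ∀ y ∉ U, Z' y = 0 := by
  obtain ⟨ρ, -, hρ⟩ := (SmoothBumpFunction.nhds_basis_tsupport (I := 𝓡 n) x).mem_iff.1
    (hU.mem_nhds hx)
  refine ⟨fun y => ρ y • Z y, ContMDiff.smul_section ρ.contMDiff hZ, ?_, fun y => ⟨ρ y, rfl⟩, ?_⟩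
  · change ρ x • Z x = Z x
    rw [ρ.eq_one, one_smul]
  · intro y hy
    change ρ y • Z y = 0
    rw [image_eq_zero_of_notMem_tsupport fun h => hy (hρ h), zero_smul]

/-- Independence is an open condition on the continuous coordinate expressions, and vectors with
independent images under the derivative of the chart are independent. -/
theorem isOpen_independenceSet {X₁ X₂ : VectorField n M} (hX₁ : X₁.Smooth) (hX₂ : X₂.Smooth) :
    IsOpen (independenceSet X₁ X₂) := by
  rw [isOpen_iff_mem_nhds]
  intro x hx
  have hcont : ∀ {Z : VectorField n M}, Z.Smooth →
      ContinuousAt (fun y => chartField x Z (extChartAt (𝓡 n) x y)) x := fun hZ =>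
    (hZ.contDiffAt_chartField (mem_extChartAt_target x)).continuousAt.comp
      (continuousAt_extChartAt x)
  have h1 : ContinuousAt (fun y => ![chartField x X₁ (extChartAt (𝓡 n) x y),
      chartField x X₂ (extChartAt (𝓡 n) x y)]) x := by
    refine continuousAt_pi.2 fun i => ?_
    fin_cases i
    · exact hcont hX₁
    · exact hcont hX₂
  have h2 : LinearIndependent ℝ ![chartField x X₁ (extChartAt (𝓡 n) x x),
      chartField x X₂ (extChartAt (𝓡 n) x x)] := by
    rw [chartField_extChartAt_self, chartField_extChartAt_self]
    exact hx
  filter_upwards [h1.eventually h2.eventually, extChartAt_source_mem_nhds (I := 𝓡 n) x]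
    with y hy hys
  rw [chartField_extChartAt hys, chartField_extChartAt hys] at hy
  refine LinearIndependent.of_comp (mfderiv (𝓡 n) 𝓘(ℝ, EuclideanSpace ℝ (Fin n))
    (extChartAt (𝓡 n) x) y).toLinearMap ?_
  convert! hy using 1
  ext i : 1
  fin_cases i <;> rfl

end Extension

/-! ### From integral maps in a chart to integral manifolds -/

section IntegralManifold

variable {n : ℕ} {M : Type*} [TopologicalSpace M] [ChartedSpace (EuclideanSpace ℝ (Fin n)) M]

theorem isIntegralManifoldAt_const {D : ∀ x : M, Submodule ℝ (TangentSpace (𝓡 n) x)} {x : M}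
    (hx : D x = ⊥) :
    IsIntegralManifoldAt D x (k := 0) univ fun _ => x where
  isOpen := isOpen_univ
  zero_mem := mem_univ _
  map_zero := rfl
  smooth := contMDiffOn_const
  injOn := fun _ _ _ _ _ => Subsingleton.elim _ _
  immersion := fun _ _ a b _ =>
    (inferInstance : Subsingleton (EuclideanSpace ℝ (Fin 0))).elim a b
  tangent := fun w _ => by
    rw [mfderiv_const, hx]
    exact LinearMap.range_zero

variable [IsManifold (𝓡 n) ∞ M]

theorem map_mfderiv_symm_span_chartField {x : M} {u : EuclideanSpace ℝ (Fin n)}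
    (hu : u ∈ (extChartAt (𝓡 n) x).target) (Z₁ Z₂ Z₃ Z₄ : VectorField n M) :
    (Submodule.span ℝ {chartField x Z₁ u, chartField x Z₂ u, chartField x Z₃ u,
      chartField x Z₄ u}).map (mfderiv 𝓘(ℝ, EuclideanSpace ℝ (Fin n)) (𝓡 n)
        (extChartAt (𝓡 n) x).symm u : EuclideanSpace ℝ (Fin n) →L[ℝ]
          TangentSpace (𝓡 n) ((extChartAt (𝓡 n) x).symm u)).toLinearMap =
    Submodule.span ℝ {Z₁ ((extChartAt (𝓡 n) x).symm u), Z₂ ((extChartAt (𝓡 n) x).symm u),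
      Z₃ ((extChartAt (𝓡 n) x).symm u), Z₄ ((extChartAt (𝓡 n) x).symm u)} := by
  exact map_span_four _ (mfderiv_symm_chartField Z₁ hu) (mfderiv_symm_chartField Z₂ hu)
    (mfderiv_symm_chartField Z₃ hu) (mfderiv_symm_chartField Z₄ hu)

/-- Integral manifolds of the distribution spanned by four independent vector fields in a chart. -/
theorem exists_isIntegralManifoldAt {D : ∀ x : M, Submodule ℝ (TangentSpace (𝓡 n) x)} {x : M}
    {Z₁ Z₂ Z₃ Z₄ : VectorField n M}
    (hD : ∀ᶠ y in 𝓝 x, D y = Submodule.span ℝ {Z₁ y, Z₂ y, Z₃ y, Z₄ y} ∧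
      LinearIndependent ℝ ![Z₁ y, Z₂ y, Z₃ y, Z₄ y])
    {D' : EuclideanSpace ℝ (Fin n) → Submodule ℝ (EuclideanSpace ℝ (Fin n))}
    (hD' : ∀ᶠ u in 𝓝 (extChartAt (𝓡 n) x x), D' u = Submodule.span ℝ
      {chartField x Z₁ u, chartField x Z₂ u, chartField x Z₃ u, chartField x Z₄ u})
    (hint : HasIntegralMap D' (extChartAt (𝓡 n) x x) 4) :
    ∃ (W : Set (EuclideanSpace ℝ (Fin 4))) (φ : EuclideanSpace ℝ (Fin 4) → M),
      IsIntegralManifoldAt D x W φ := by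
  obtain ⟨ψ, hψ0, hψ⟩ := hint
  set e := extChartAt (𝓡 n) x with he
  have hψc : Tendsto ψ (𝓝 0) (𝓝 (e x)) := by
    have := hψ.self_of_nhds.1.continuousAt
    rwa [ContinuousAt, hψ0] at this
  have hsymm : Tendsto e.symm (𝓝 (e x)) (𝓝 x) := by
    have := continuousAt_extChartAt_symm (I := 𝓡 n) x
    rwa [ContinuousAt, extChartAt_to_inv] at this
  have hT : ∀ᶠ u in 𝓝 (e x), u ∈ e.target := extChartAt_target_mem_nhds x
  set φ : EuclideanSpace ℝ (Fin 4) → M := fun w => e.symm (ψ w) with hφ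
  have hev := (((hψ.and (hψc.eventually hT)).and (hψc.eventually hD')).and
    (hψc.eventually (hsymm.eventually hD)))
  let A : ∀ w, EuclideanSpace ℝ (Fin 4) →L[ℝ] TangentSpace (𝓡 n) (φ w) :=
    fun w => mfderiv (𝓡 4) (𝓡 n) φ w
  have hcomp : ∀ w, ContDiffAt ℝ ∞ ψ w → ψ w ∈ e.target → ∀ v, A w v =
      mfderiv 𝓘(ℝ, EuclideanSpace ℝ (Fin n)) (𝓡 n) e.symm (ψ w) (fderiv ℝ ψ w v) := by
    intro w hw hwt v
    have h1 := mfderiv_comp w (mdifferentiableAt_extChartAt_symm' hwt)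
      (hw.differentiableAt (by simp)).mdifferentiableAt
    rw [mfderiv_eq_fderiv] at h1
    exact DFunLike.congr_fun h1 v
  have hrange : ∀ᶠ w in 𝓝 0, (A w).toLinearMap.range = D (φ w) := by
    filter_upwards [hev] with w hw
    obtain ⟨⟨⟨⟨hs, hr⟩, ht⟩, hd'⟩, hd, -⟩ := hw
    rw [hd, ← map_mfderiv_symm_span_chartField ht, ← hd', ← hr]
    ext v
    constructor
    · rintro ⟨a, rfl⟩
      exact ⟨_, ⟨a, rfl⟩, (hcomp w hs ht a).symm⟩
    · rintro ⟨_, ⟨a, rfl⟩, rfl⟩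
      exact ⟨a, hcomp w hs ht a⟩
  -- The range is spanned by four independent vectors, so it has the dimension of the source, and
  -- rank-nullity leaves no kernel.
  have hinj : ∀ᶠ w in 𝓝 0, Function.Injective (A w) := by
    filter_upwards [hrange, hev] with w hr hw
    obtain ⟨-, hd, hli⟩ := hw
    have h1 := finrank_span_eq_card hli
    rw [Matrix.range_cons, Matrix.range_cons, Matrix.range_cons, Matrix.range_cons,
      Matrix.range_empty, union_empty, singleton_union, singleton_union, singleton_union, ← hd,
      ← hr, Fintype.card_fin] at h1
    have h2 := (A w).toLinearMap.finrank_range_add_finrank_ker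
    rw [h1, finrank_euclideanSpace_fin] at h2
    have h3 : Module.finrank ℝ (A w).toLinearMap.ker = 0 := by omega
    exact LinearMap.ker_eq_bot.1 (Submodule.finrank_eq_zero.1 h3)
  have hψinj : Function.Injective (fderiv ℝ ψ 0) := by
    obtain ⟨⟨⟨⟨hs, -⟩, ht⟩, -⟩, -⟩ := hev.self_of_nhds
    intro a b hab
    refine hinj.self_of_nhds ?_
    rw [hcomp 0 hs ht, hcomp 0 hs ht, hab]
  obtain ⟨s, hs, hsinj⟩ := exists_injOn_of_injective_fderiv
    (hψ.self_of_nhds.1.of_le ENat.LEInfty.out) hψinj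
  obtain ⟨W, hW, hWo, h0W⟩ := mem_nhds_iff.1 (((hrange.and hinj).and hev).and hs)
  refine ⟨W, φ, hWo, h0W, ?_, fun w hw => ?_, ?_, fun w hw => (hW hw).1.1.2,
    fun w hw => (hW hw).1.1.1⟩
  · simp only [hφ, hψ0]
    exact extChartAt_to_inv x
  · obtain ⟨⟨⟨⟨hs, -⟩, ht⟩, -⟩, -⟩ := (hW hw).1.2
    exact (((contMDiffOn_extChartAt_symm (n := ∞) x).contMDiffAt
      ((isOpen_extChartAt_target x).mem_nhds ht)).comp w hs.contMDiffAt).contMDiffWithinAt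
  · intro a ha b hb hab
    have hta := (hW ha).1.2.1.1.2
    have htb := (hW hb).1.2.1.1.2
    exact hsinj (hW ha).2 (hW hb).2 (e.symm.injOn hta htb hab)

end IntegralManifold

/-! ### Brackets of fields tangent to integral manifolds -/

section Bracket

variable {n : ℕ} {M : Type*} [TopologicalSpace M] [ChartedSpace (EuclideanSpace ℝ (Fin n)) M]
  [IsManifold (𝓡 n) ∞ M]

/-- A distribution with an integral manifold through `x` contains the bracket at `x` of any two
vector fields that take values in it near `x`. -/
theorem IsIntegralManifoldAt.bracketAt_mem {D : ∀ x : M, Submodule ℝ (TangentSpace (𝓡 n) x)}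
    {x : M} {k : ℕ} {W : Set (EuclideanSpace ℝ (Fin k))} {φ : EuclideanSpace ℝ (Fin k) → M}
    (hφ : IsIntegralManifoldAt D x W φ) {Z₁ Z₂ : VectorField n M} (hZ₁ : Z₁.Smooth)
    (hZ₂ : Z₂.Smooth) (h₁ : ∀ᶠ y in 𝓝 x, Z₁ y ∈ D y) (h₂ : ∀ᶠ y in 𝓝 x, Z₂ y ∈ D y) :
    bracketAt Z₁ Z₂ x ∈ D x := by
  have : IsManifold (𝓡 n) 1 M := .of_le (n := ∞) (by simp)
  set e := extChartAt (𝓡 n) x with he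
  set ψ : EuclideanSpace ℝ (Fin k) → EuclideanSpace ℝ (Fin n) := fun w => e (φ w) with hψ
  have hW : W ∈ 𝓝 (0 : EuclideanSpace ℝ (Fin k)) := hφ.isOpen.mem_nhds hφ.zero_mem
  have hsm : ∀ w ∈ W, ContMDiffAt (𝓡 k) (𝓡 n) ∞ φ w := fun w hw =>
    hφ.smooth.contMDiffAt (hφ.isOpen.mem_nhds hw)
  have hφc : Tendsto φ (𝓝 0) (𝓝 x) := by
    have := (hsm 0 hφ.zero_mem).continuousAt
    rwa [ContinuousAt, hφ.map_zero] at this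
  have hψ0 : ψ 0 = e x := by rw [hψ, ← hφ.map_zero]
  have hψs : ContDiffAt ℝ ∞ ψ 0 := by
    rw [← contMDiffAt_iff_contDiffAt]
    refine ContMDiffAt.comp (0 : EuclideanSpace ℝ (Fin k)) (I' := 𝓡 n)
      (contMDiffAt_extChartAt_of_mem_source ?_) (hsm 0 hφ.zero_mem)
    rw [hφ.map_zero]
    exact mem_extChartAt_source x
  let A : ∀ w, EuclideanSpace ℝ (Fin k) →L[ℝ] TangentSpace (𝓡 n) (φ w) :=
    fun w => mfderiv (𝓡 k) (𝓡 n) φ w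
  have hcomp : ∀ w ∈ W, φ w ∈ e.source → ∀ v, fderiv ℝ ψ w v =
      mfderiv (𝓡 n) 𝓘(ℝ, EuclideanSpace ℝ (Fin n)) e (φ w) (A w v) := by
    intro w hw hws v
    have h := mfderiv_comp w ((contMDiffAt_extChartAt_of_mem_source hws).mdifferentiableAt
      (by simp)) ((hsm w hw).mdifferentiableAt (by simp))
    refine Eq.trans ?_ (DFunLike.congr_fun h v)
    exact DFunLike.congr_fun (mfderiv_eq_fderiv (f := ψ)).symm v
  have hx0 : φ 0 ∈ e.source := by rw [hφ.map_zero]; exact mem_extChartAt_source x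
  have hcomp0 : ∀ v, fderiv ℝ ψ 0 v = A 0 v := by
    intro v
    refine (hcomp 0 hφ.zero_mem hx0 v).trans ?_
    have h1 := mfderiv_extChartAt_self (I := 𝓡 n) (x := x)
    have h2 : ∀ y, y = x → ∀ a : EuclideanSpace ℝ (Fin n),
        mfderiv (𝓡 n) 𝓘(ℝ, EuclideanSpace ℝ (Fin n)) e y a = a := by
      rintro y rfl a
      exact DFunLike.congr_fun h1 a
    exact h2 _ hφ.map_zero _
  have hinj : Function.Injective (fderiv ℝ ψ 0) := fun a b hab =>
    hφ.immersion 0 hφ.zero_mem ((hcomp0 a).symm.trans (hab.trans (hcomp0 b)))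
  have hmem : ∀ {Z : VectorField n M}, (∀ᶠ y in 𝓝 x, Z y ∈ D y) →
      ∀ᶠ w in 𝓝 0, chartField x Z (ψ w) ∈ (fderiv ℝ ψ w).toLinearMap.range := by
    intro Z hZ
    filter_upwards [hφc.eventually hZ, hφc.eventually (extChartAt_source_mem_nhds (I := 𝓡 n) x),
      hW] with w hw hws hwW
    rw [← hφ.tangent w hwW] at hw
    obtain ⟨v, hv⟩ := hw
    refine ⟨v, (hcomp w hwW hws v).trans ?_⟩
    refine Eq.trans ?_ (chartField_extChartAt hws Z).symm
    exact congrArg _ hv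
  have hd : ∀ {Z : VectorField n M}, Z.Smooth → DifferentiableAt ℝ (chartField x Z) (ψ 0) := by
    intro Z hZ
    rw [hψ0]
    exact hZ.differentiableAt_chartField (mem_extChartAt_target x)
  have key := lieBracket_mem_range (hψs.of_le ENat.LEInfty.out) hinj (hd hZ₁) (hd hZ₂)
    (hmem h₁) (hmem h₂)
  rw [hψ0] at key
  obtain ⟨v, hv⟩ := key
  have h3 : A 0 v ∈ D (φ 0) := by
    rw [← hφ.tangent 0 hφ.zero_mem]
    exact ⟨v, rfl⟩
  have h4 : A 0 v = bracketAt Z₁ Z₂ x := (hcomp0 v).symm.trans hv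
  -- `φ 0 = x` is not definitional; membership is transported through the common model space of the
  -- tangent spaces.
  have h5 : ∀ y, y = x → ∀ a : EuclideanSpace ℝ (Fin n),
      a ∈ (D y : Submodule ℝ (TangentSpace (𝓡 n) y)) → a ∈ D x := by
    rintro y rfl a ha
    exact ha
  have h6 := h5 _ hφ.map_zero _ h3
  rwa [h4] at h6

end Bracket

/-! ### The foliation spanned by `Y₁, Y₂, X₁, X₂` -/

section SpanFoliation

variable {n : ℕ} {M : Type*} [TopologicalSpace M]
  [ChartedSpace (EuclideanSpace ℝ (Fin n)) M] [IsManifold (𝓡 n) ∞ M]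

/-- Frobenius is applied in the chart at `x`. It asks for fields smooth on the whole model space, so
the coordinate expressions are replaced by global ones with the same germ, which leaves brackets
near the centre unchanged. -/
theorem exists_isIntegralManifoldAt_span_four {D : ∀ x : M, Submodule ℝ (TangentSpace (𝓡 n) x)}
    {U : Set M} (hU : IsOpen U) {X₁ X₂ Y₁ Y₂ : VectorField n M} (hX₁ : X₁.Smooth)
    (hX₂ : X₂.Smooth) (hY₁ : Y₁.Smooth) (hY₂ : Y₂.Smooth)
    (hXX : ∀ x : M, ∀ u ∈ (extChartAt (𝓡 n) x).target,
      lieBracket ℝ (chartField x X₁) (chartField x X₂) u = 0)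
    (h₁₁ : ∀ x : M, ∀ u ∈ (extChartAt (𝓡 n) x).target,
      lieBracket ℝ (chartField x X₁) (chartField x Y₁) u = 0)
    (h₁₂ : ∀ x : M, ∀ u ∈ (extChartAt (𝓡 n) x).target,
      lieBracket ℝ (chartField x X₁) (chartField x Y₂) u = 0)
    (h₂₁ : ∀ x : M, ∀ u ∈ (extChartAt (𝓡 n) x).target,
      lieBracket ℝ (chartField x X₂) (chartField x Y₁) u = 0)
    (h₂₂ : ∀ x : M, ∀ u ∈ (extChartAt (𝓡 n) x).target,
      lieBracket ℝ (chartField x X₂) (chartField x Y₂) u = 0)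
    (hYY : ∀ x ∈ U, bracketAt Y₁ Y₂ x ∈ Submodule.span ℝ {X₁ x, X₂ x})
    (hD : ∀ x ∈ U, D x = Submodule.span ℝ {Y₁ x, Y₂ x, X₁ x, X₂ x})
    (hli : ∀ x ∈ U, LinearIndependent ℝ ![Y₁ x, Y₂ x, X₁ x, X₂ x]) {x : M} (hx : x ∈ U) :
    ∃ (W : Set (EuclideanSpace ℝ (Fin 4))) (φ : EuclideanSpace ℝ (Fin 4) → M),
      IsIntegralManifoldAt D x W φ := by
  set e := extChartAt (𝓡 n) x with he
  have hT : ∀ᶠ u in 𝓝 (e x), u ∈ e.target := extChartAt_target_mem_nhds x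
  have hsymm : Tendsto e.symm (𝓝 (e x)) (𝓝 x) := by
    have := continuousAt_extChartAt_symm (I := 𝓡 n) x
    rwa [ContinuousAt, extChartAt_to_inv] at this
  have hext : ∀ {Z : VectorField n M}, Z.Smooth → ∃ g : EuclideanSpace ℝ (Fin n) →
      EuclideanSpace ℝ (Fin n), ContDiff ℝ ∞ g ∧ g =ᶠ[𝓝 (e x)] chartField x Z := fun hZ =>
    exists_contDiff_eventuallyEq (isOpen_extChartAt_target x) (hZ.contDiffOn_chartField x)
      (mem_extChartAt_target x)
  obtain ⟨A₁, hA₁, hA₁'⟩ := hext hX₁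
  obtain ⟨A₂, hA₂, hA₂'⟩ := hext hX₂
  obtain ⟨B₁, hB₁, hB₁'⟩ := hext hY₁
  obtain ⟨B₂, hB₂, hB₂'⟩ := hext hY₂
  have hzero : ∀ {f g : EuclideanSpace ℝ (Fin n) → EuclideanSpace ℝ (Fin n)}
      {V W : VectorField n M}, f =ᶠ[𝓝 (e x)] chartField x V → g =ᶠ[𝓝 (e x)] chartField x W →
      (∀ u ∈ e.target, lieBracket ℝ (chartField x V) (chartField x W) u = 0) →
      ∀ᶠ p in 𝓝 (e x), lieBracket ℝ f g p = 0 := by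
    intro f g V W hf hg h
    filter_upwards [hf.lieBracket_vectorField (𝕜 := ℝ) hg, hT] with p hp hpT
    rw [hp, h p hpT]
  have hswap : ∀ {f g : EuclideanSpace ℝ (Fin n) → EuclideanSpace ℝ (Fin n)},
      (∀ᶠ p in 𝓝 (e x), lieBracket ℝ f g p = 0) → ∀ᶠ p in 𝓝 (e x), lieBracket ℝ g f p = 0 := by
    intro f g h
    filter_upwards [h] with p hp
    rw [lieBracket_swap, hp, neg_zero]
  refine exists_isIntegralManifoldAt (Z₁ := Y₁) (Z₂ := Y₂) (Z₃ := X₁) (Z₄ := X₂) ?_ ?_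
    (hasIntegralMap_four (e x) hA₁ hA₂ hB₁ hB₂ (hzero hA₁' hA₂' (hXX x))
      (hswap (hzero hA₁' hB₁' (h₁₁ x))) (hswap (hzero hA₂' hB₁' (h₂₁ x)))
      (hswap (hzero hA₁' hB₂' (h₁₂ x))) (hswap (hzero hA₂' hB₂' (h₂₂ x))) ?_)
  · filter_upwards [hU.mem_nhds hx] with y hy using ⟨hD y hy, hli y hy⟩
  · filter_upwards [hA₁', hA₂', hB₁', hB₂'] with p h1 h2 h3 h4
    rw [h1, h2, h3, h4]
  · filter_upwards [hB₁'.lieBracket_vectorField (𝕜 := ℝ) hB₂', hT, hsymm.eventually (hU.mem_nhds hx), hA₁',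
      hA₂'] with p hp hpT hpU h1 h2
    rw [hp, h1, h2]
    -- `hYY` speaks of the chart centred at each point, whereas here the chart at `x` is kept fixed.
    have h3 := lieBracket_chartField_mem_span (X₁ := X₁) (X₂ := X₂) hY₁ hY₂
      (e.map_target hpT) (by
        rw [chartField_extChartAt_self, chartField_extChartAt_self]
        exact hYY _ hpU)
    rwa [← he, e.right_inv hpT] at h3

/-- The singular foliation that is spanned by four vector fields on an open set and is zero
outside. -/
theorem exists_foliation_span_four [T2Space M] {U : Set M} (hU : IsOpen U) {X₁ X₂ Y₁ Y₂ : VectorField n M}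
    (hX₁ : X₁.Smooth) (hX₂ : X₂.Smooth) (hY₁ : Y₁.Smooth) (hY₂ : Y₂.Smooth)
    (hXX : ∀ x : M, ∀ u ∈ (extChartAt (𝓡 n) x).target,
      lieBracket ℝ (chartField x X₁) (chartField x X₂) u = 0)
    (h₁₁ : ∀ x : M, ∀ u ∈ (extChartAt (𝓡 n) x).target,
      lieBracket ℝ (chartField x X₁) (chartField x Y₁) u = 0)
    (h₁₂ : ∀ x : M, ∀ u ∈ (extChartAt (𝓡 n) x).target,
      lieBracket ℝ (chartField x X₁) (chartField x Y₂) u = 0)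
    (h₂₁ : ∀ x : M, ∀ u ∈ (extChartAt (𝓡 n) x).target,
      lieBracket ℝ (chartField x X₂) (chartField x Y₁) u = 0)
    (h₂₂ : ∀ x : M, ∀ u ∈ (extChartAt (𝓡 n) x).target,
      lieBracket ℝ (chartField x X₂) (chartField x Y₂) u = 0)
    (hYY : ∀ x ∈ U, bracketAt Y₁ Y₂ x ∈ Submodule.span ℝ {X₁ x, X₂ x})
    (hli : ∀ x ∈ U, LinearIndependent ℝ ![Y₁ x, Y₂ x, X₁ x, X₂ x]) :
    ∃ S : Foliation n M, ∀ x ∈ U, S.tangent x = Submodule.span ℝ {Y₁ x, Y₂ x, X₁ x, X₂ x} := by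
  classical
  let D : ∀ x : M, Submodule ℝ (TangentSpace (𝓡 n) x) := fun x =>
    if x ∈ U then Submodule.span ℝ {Y₁ x, Y₂ x, X₁ x, X₂ x} else ⊥
  have hD : ∀ x ∈ U, D x = Submodule.span ℝ {Y₁ x, Y₂ x, X₁ x, X₂ x} := fun x hx => if_pos hx
  have hD' : ∀ x ∉ U, D x = ⊥ := fun x hx => if_neg hx
  refine ⟨⟨D, fun x v hv => ?_, fun x => ?_⟩, hD⟩
  · by_cases hx : x ∈ U
    · rw [hD x hx] at hv
      obtain ⟨b₁, w, hw, hvw⟩ := Submodule.mem_span_insert.1 hv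
      obtain ⟨b₂, w', hw', hww'⟩ := Submodule.mem_span_insert.1 hw
      obtain ⟨c₁, c₂, hc⟩ := Submodule.mem_span_pair.1 hw'
      have hZ : VectorField.Smooth ((1 : ℝ) • (b₁ • Y₁ + b₂ • Y₂) + (1 : ℝ) • (c₁ • X₁ + c₂ • X₂)) :=
        (hY₁.smul_add_smul hY₂ b₁ b₂).smul_add_smul (hX₁.smul_add_smul hX₂ c₁ c₂) 1 1
      -- The cutoff multiplies by scalars, so values stay in the span on `U`, and it vanishes off
      -- `U`, where `D` is zero.
      obtain ⟨Z, hZs, hZx, hZr, hZ0⟩ := exists_smooth_smul_eq hU hx hZ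
      refine ⟨Z, hZs, fun y => ?_, ?_⟩
      · by_cases hy : y ∈ U
        · obtain ⟨r, hr⟩ := hZr y
          rw [hD y hy, hr]
          refine Submodule.smul_mem _ _ (Submodule.add_mem _ (Submodule.smul_mem _ _
            (Submodule.add_mem _ ?_ ?_)) (Submodule.smul_mem _ _ (Submodule.add_mem _ ?_ ?_))) <;>
          exact Submodule.smul_mem _ _ (Submodule.subset_span (by simp))
        · rw [hZ0 y hy]
          exact Submodule.zero_mem _
      · rw [hZx, hvw, hww', ← hc]
        change (1 : ℝ) • (b₁ • Y₁ x + b₂ • Y₂ x) + (1 : ℝ) • (c₁ • X₁ x + c₂ • X₂ x) = _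
        rw [one_smul, one_smul, add_assoc]
    · rw [hD' x hx] at hv
      refine ⟨fun _ => 0, Bundle.contMDiff_zeroSection ℝ _, fun y => Submodule.zero_mem _, ?_⟩
      exact ((Submodule.mem_bot ℝ).1 hv).symm
  · by_cases hx : x ∈ U
    · exact ⟨4, exists_isIntegralManifoldAt_span_four hU hX₁ hX₂ hY₁ hY₂ hXX h₁₁ h₁₂ h₂₁ h₂₂ hYY hD
        hli hx⟩
    · exact ⟨0, univ, fun _ => x, isIntegralManifoldAt_const (hD' x hx)⟩

end SpanFoliation

end ToricPoisson

end

/-! ### The equivalence -/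

theorem proposition6p7 {n : ℕ} {M : Type*} [TopologicalSpace M] [T2Space M]
    [SecondCountableTopology M] [ChartedSpace (EuclideanSpace ℝ (Fin n)) M]
    [IsManifold (𝓡 n) ∞ M] [MulAction (Circle × Circle) M]
    [ContMDiffSMul ((𝓡 1).prod (𝓡 1)) (𝓡 n) ∞ (Circle × Circle) M]
    (X₁ X₂ : ToricPoisson.VectorField n M) (hX₁ : X₁.Smooth) (hX₂ : X₂.Smooth)
    (hX : ToricPoisson.AreGenerators X₁ X₂)
    (h₁ h₂ : M → ℝ) (hh₁ : ContMDiff (𝓡 n) 𝓘(ℝ, ℝ) ∞ h₁) (hh₂ : ContMDiff (𝓡 n) 𝓘(ℝ, ℝ) ∞ h₂)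
    (hinv₁ : ToricPoisson.InvariantFunction h₁) (hinv₂ : ToricPoisson.InvariantFunction h₂)
    (Y₁ Y₂ : ToricPoisson.VectorField n M) (hY₁ : Y₁.Smooth) (hY₂ : Y₂.Smooth)
    (hYinv₁ : ToricPoisson.InvariantVectorField Y₁)
    (hYinv₂ : ToricPoisson.InvariantVectorField Y₂)
    (hnorm₁ : ∀ x : M, ToricPoisson.differential n h₁ x (Y₁ x) • X₁ x
      + ToricPoisson.differential n h₁ x (Y₂ x) • X₂ x = X₁ x)
    (hnorm₂ : ∀ x : M, ToricPoisson.differential n h₂ x (Y₁ x) • X₁ x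
      + ToricPoisson.differential n h₂ x (Y₂ x) • X₂ x = X₂ x) :
    ToricPoisson.IsPoisson (ToricPoisson.wedge Y₁ X₁ + ToricPoisson.wedge Y₂ X₂) ↔
      ∃ S : ToricPoisson.Foliation n M,
        S.IsCompatibleOn h₁ h₂ (ToricPoisson.independenceSet X₁ X₂) ∧
        ∀ x ∈ ToricPoisson.independenceSet X₁ X₂, Y₁ x ∈ S.tangent x ∧ Y₂ x ∈ S.tangent x := by
  have hc₁ : ContMDiff 𝓘(ℝ, ℝ) ((𝓡 1).prod (𝓡 1)) ∞
      (fun t : ℝ => ((Circle.exp t, 1) : Circle × Circle)) :=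
    contMDiff_circleExp.prodMk contMDiff_const
  have hc₂ : ContMDiff 𝓘(ℝ, ℝ) ((𝓡 1).prod (𝓡 1)) ∞
      (fun t : ℝ => ((1, Circle.exp t) : Circle × Circle)) :=
    contMDiff_const.prodMk contMDiff_circleExp
  have h0₁ : ((Circle.exp 0, 1) : Circle × Circle) = 1 := by rw [Circle.exp_zero]; rfl
  have h0₂ : ((1, Circle.exp 0) : Circle × Circle) = 1 := by rw [Circle.exp_zero]; rfl
  have hX₁' := fun x => (hX x).1
  have hX₂' := fun x => (hX x).2
  have hXinv₂ := ToricPoisson.invariantVectorField_generator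
    (c := fun t : ℝ => ((1, Circle.exp t) : Circle × Circle)) h0₂ hX₂'
  have b₁ : ∀ {Z : ToricPoisson.VectorField n M}, Z.Smooth →
      ToricPoisson.InvariantVectorField Z → ∀ x : M, ∀ u ∈ (extChartAt (𝓡 n) x).target,
      VectorField.lieBracket ℝ (ToricPoisson.chartField x X₁) (ToricPoisson.chartField x Z) u = 0 :=
    fun hZ hinv _ _ hu => ToricPoisson.lieBracket_chartField_eq_zero hc₁ h0₁ hX₁' hZ hinv hu
  have b₂ : ∀ {Z : ToricPoisson.VectorField n M}, Z.Smooth →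
      ToricPoisson.InvariantVectorField Z → ∀ x : M, ∀ u ∈ (extChartAt (𝓡 n) x).target,
      VectorField.lieBracket ℝ (ToricPoisson.chartField x X₂) (ToricPoisson.chartField x Z) u = 0 :=
    fun hZ hinv _ _ hu => ToricPoisson.lieBracket_chartField_eq_zero hc₂ h0₂ hX₂' hZ hinv hu
  have x₁₁ := ToricPoisson.differential_generator_eq_zero
    (c := fun t : ℝ => ((Circle.exp t, 1) : Circle × Circle)) hh₁ hinv₁ h0₁ hX₁'
  have x₁₂ := ToricPoisson.differential_generator_eq_zero
    (c := fun t : ℝ => ((1, Circle.exp t) : Circle × Circle)) hh₁ hinv₁ h0₂ hX₂'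
  have x₂₁ := ToricPoisson.differential_generator_eq_zero
    (c := fun t : ℝ => ((Circle.exp t, 1) : Circle × Circle)) hh₂ hinv₂ h0₁ hX₁'
  have x₂₂ := ToricPoisson.differential_generator_eq_zero
    (c := fun t : ℝ => ((1, Circle.exp t) : Circle × Circle)) hh₂ hinv₂ h0₂ hX₂'
  -- Coefficients of the independent vectors `X₁ x, X₂ x` are compared in the normalisation.
  have hd₁ : ∀ x ∈ ToricPoisson.independenceSet X₁ X₂,
      ToricPoisson.differential n h₁ x (Y₁ x) = 1 ∧ ToricPoisson.differential n h₁ x (Y₂ x) = 0 := by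
    intro x hx
    have := LinearIndependent.pair_iff.1 hx (ToricPoisson.differential n h₁ x (Y₁ x) - 1)
      (ToricPoisson.differential n h₁ x (Y₂ x))
      (by rw [sub_smul, one_smul, sub_add_eq_add_sub, hnorm₁ x, sub_self])
    exact ⟨sub_eq_zero.1 this.1, this.2⟩
  have hd₂ : ∀ x ∈ ToricPoisson.independenceSet X₁ X₂,
      ToricPoisson.differential n h₂ x (Y₁ x) = 0 ∧ ToricPoisson.differential n h₂ x (Y₂ x) = 1 := by
    intro x hx
    have := LinearIndependent.pair_iff.1 hx (ToricPoisson.differential n h₂ x (Y₁ x))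
      (ToricPoisson.differential n h₂ x (Y₂ x) - 1)
      (by rw [sub_smul, one_smul, ← add_sub_assoc, hnorm₂ x, sub_self])
    exact ⟨this.1, sub_eq_zero.1 this.2⟩
  have hU := ToricPoisson.isOpen_independenceSet hX₁ hX₂
  rw [ToricPoisson.isPoisson_iff_bracketAt_mem_span hY₁ hX₁ hY₂ hX₂ (b₁ hX₂ hXinv₂)
    (b₁ hY₁ hYinv₁) (b₁ hY₂ hYinv₂) (b₂ hY₁ hYinv₁) (b₂ hY₂ hYinv₂)]
  constructor
  · intro h
    obtain ⟨S, hS⟩ := ToricPoisson.exists_foliation_span_four hU hX₁ hX₂ hY₁ hY₂ (b₁ hX₂ hXinv₂)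
      (b₁ hY₁ hYinv₁) (b₁ hY₂ hYinv₂) (b₂ hY₁ hYinv₁) (b₂ hY₂ hYinv₂) h
      fun x hx => ToricPoisson.linearIndependent_four hx (hd₁ x hx).1 (hd₁ x hx).2 (hd₂ x hx).1
        (hd₂ x hx).2 (x₁₁ x) (x₁₂ x) (x₂₁ x) (x₂₂ x)
    have horb : ∀ x ∈ ToricPoisson.independenceSet X₁ X₂, ToricPoisson.orbitTangent n x =
        S.tangent x ⊓ ToricPoisson.levelTangent n h₁ h₂ x := by
      intro x hx
      rw [ToricPoisson.orbitTangent_eq_span hX, hS x hx]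
      exact ToricPoisson.span_pair_eq_span_four_inf_ker (hd₁ x hx).1 (hd₁ x hx).2 (hd₂ x hx).1
        (hd₂ x hx).2 (x₁₁ x) (x₁₂ x) (x₂₁ x) (x₂₂ x)
    refine ⟨S, ⟨fun x hx => ?_, fun x hx => ?_, horb⟩, fun x hx => ?_⟩
    · rw [hS x hx]
      exact ToricPoisson.span_four_sup_ker_eq_top (hd₁ x hx).1 (hd₁ x hx).2 (hd₂ x hx).1
        (hd₂ x hx).2
    · rw [horb x hx]
      exact inf_le_left
    · rw [hS x hx]
      exact ⟨Submodule.subset_span (by simp), Submodule.subset_span (by simp)⟩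
  · rintro ⟨S, hS, hY⟩ x hx
    obtain ⟨k, W, φ, hφ⟩ := S.integrable x
    have hev := hU.mem_nhds hx
    -- The goal becomes tangency to `S`, which follows from integrability, together with vanishing
    -- under `dh₁` and `dh₂`.
    rw [← ToricPoisson.orbitTangent_eq_span hX, hS.orbit_eq x hx]
    refine ⟨hφ.bracketAt_mem hY₁ hY₂ ?_ ?_, ?_, ?_⟩
    · filter_upwards [hev] with y hy using (hY y hy).1
    · filter_upwards [hev] with y hy using (hY y hy).2
    · refine ToricPoisson.differential_bracketAt_eq_zero (c₁ := 1) (c₂ := 0) hY₁ hY₂ hh₁ ?_ ?_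
      · filter_upwards [hev] with y hy using (hd₁ y hy).1
      · filter_upwards [hev] with y hy using (hd₁ y hy).2
    · refine ToricPoisson.differential_bracketAt_eq_zero (c₁ := 0) (c₂ := 1) hY₁ hY₂ hh₂ ?_ ?_
      · filter_upwards [hev] with y hy using (hd₂ y hy).1
      · filter_upwards [hev] with y hy using (hd₂ y hy).2
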